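/- Let $\eta\in\mathbb R$. For real $L>-1$ let $$F_{L,\eta}(z)=C_L(\eta)\,z^{L+1}\sum_{n\ge 0}a_{L,n}z^n,\qquad C_L(\eta)=\frac{2^Le^{-\pi\eta/2}|\Gamma(L+1+i\eta)|}{\Gamma(2L+2)},$$ $$a_{L,0}=1,\qquad a_{L,1}=\frac{\eta}{L+1},\qquad a_{L,n}=\frac{2\eta a_{L,n-1}-a_{L,n-2}}{n(n+2L+1)}\quad(n\ge2),$$ be the regular Coulomb wave function (principal branch of $z^{L+1}$), and for integers $j\ge 2$ let $$Z_\eta^{(j)}(L)=\sum_{\rho}\frac1{\rho^{j}},$$ the sum running over all distinct non-zero complex zeros $\rho$ of $F_{L,\eta}$. For $\alpha\ge1$, $n\ge 0$ put $$p_n^{(\alpha)}=\frac{(-1)^n}{2}\Big(\frac{\alpha+1}{2}\Big)^n .$$ Define real numbers $\zeta_n^{(j)}=\zeta_{n,\eta}^{(j)}$ ($j\ge2$, $n\ge0$), depending only on $\eta$, by the following recurrences (empty sums are zero): $$\zeta_0^{(2)}=p_0^{(2)},\qquad \zeta_1^{(2)}=p_1^{(2)},\qquad \zeta_{n+2}^{(2)}=p_{n+2}^{(2)}+\sum_{m=0}^{n}(-1)^m\eta^2(m+1)p_{n-m}^{(2)}\quad(n\ge0),$$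 $$\zeta_n^{(3)}=-2\eta\sum_{l=0}^{n}\sum_{m=0}^{l}(-1)^mp_{l-m}^{(3)}\zeta_{n-l}^{(2)}\quad(n\ge0),$$ and, for $k\ge2$ and $n\ge0$, $$\zeta_0^{(2k)}=\sum_{l=0}^{k-2}\zeta_0^{(2l+2)}\zeta_0^{(2k-2l-2)}p_0^{(2k)},\qquad \zeta_1^{(2k)}=\sum_{l=0}^{k-2}\sum_{q=0}^{1}\sum_{m=0}^{q}\zeta_m^{(2l+2)}\zeta_{q-m}^{(2k-2l-2)}p_{1-q}^{(2k)},$$ $$\zeta_{n+2}^{(2k)}=\sum_{l=1}^{k-2}\sum_{q=0}^{n}\sum_{m=0}^{q}\zeta_m^{(2l+1)}\zeta_{q-m}^{(2k-2l-1)}p_{n-q}^{(2k)}+\sum_{l=0}^{k-2}\sum_{q=0}^{n+2}\sum_{m=0}^{q}\zeta_m^{(2l+2)}\zeta_{q-m}^{(2k-2l-2)}p_{n+2-q}^{(2k)}-2\eta\sum_{l=0}^{n}\sum_{m=0}^{l}(-1)^mp_{l-m}^{(2k)}\zeta_{n-l}^{(2k-1)},$$ $$\zeta_n^{(2k+1)}=-2\eta\sum_{l=0}^{n}\sum_{m=0}^{l}(-1)^mp_{l-m}^{(2k+1)}\zeta_{n-l}^{(2k)}+\sum_{l=1}^{k-1}\sum_{q=0}^{n}\sum_{m=0}^{q}\zeta_m^{(2l+1)}\zeta_{q-m}^{(2k-2l)}p_{n-q}^{(2k+1)}+\sum_{l=0}^{k-2}\sum_{q=0}^{n}\sum_{m=0}^{q}\zeta_m^{(2l+2)}\zeta_{q-m}^{(2k-2l-1)}p_{n-q}^{(2k+1)}.$$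 Then for every positive integer $k$ and every real $L>k+1$ the sums defining $Z_\eta^{(2k)}(L)$ and $Z_\eta^{(2k+1)}(L)$ converge absolutely, and they have the convergent Laurent expansions $$Z_\eta^{(2k)}(L)=\frac1{L^{2k-1}}\sum_{n\ge0}\frac{\zeta_n^{(2k)}}{L^n},\qquad Z_\eta^{(2k+1)}(L)=\frac1{L^{2k+1}}\sum_{n\ge0}\frac{\zeta_n^{(2k+1)}}{L^n}.$$ -/

import Mathlib

open scoped BigOperators

noncomputable section

/-- The normalising constant `C_L(η) = 2^L e^{-πη/2} |Γ(L+1+iη)| / Γ(2L+2)`. -/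
def coulombC (L η : ℝ) : ℝ :=
  (2 : ℝ) ^ L * Real.exp (-(Real.pi * η) / 2)
    * ‖Complex.Gamma ((L : ℂ) + 1 + Complex.I * (η : ℂ))‖ / Real.Gamma (2 * L + 2)

/-- The coefficients `a_{L,n}`: `a_{L,0} = 1`, `a_{L,1} = η/(L+1)` and
`a_{L,n} = (2η a_{L,n-1} - a_{L,n-2}) / (n (n+2L+1))` for `n ≥ 2`. -/
def coulombCoeff (L η : ℝ) : ℕ → ℝ
  | 0 => 1
  | 1 => η / (L + 1)
  | n + 2 => (2 * η * coulombCoeff L η (n + 1) - coulombCoeff L η n)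
      / (((n : ℝ) + 2) * (((n : ℝ) + 2) + 2 * L + 1))

/-- The regular Coulomb wave function
`F_{L,η}(z) = C_L(η) z^{L+1} ∑_{n ≥ 0} a_{L,n} z^n`, with the principal branch of `z^{L+1}`. -/
def coulombF (L η : ℝ) (z : ℂ) : ℂ :=
  (coulombC L η : ℂ) * z ^ ((L : ℂ) + 1) * ∑' n : ℕ, (coulombCoeff L η n : ℂ) * z ^ n

/-- The set of the non-zero (complex) zeros of `F_{L,η}`. -/
def coulombZeros (L η : ℝ) : Set ℂ :=
  {ρ : ℂ | ρ ≠ 0 ∧ coulombF L η ρ = 0}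

/-- The Rayleigh sum `Z_η^{(k)}(L) = ∑_ρ ρ^{-k}` over the non-zero zeros `ρ` of `F_{L,η}`. -/
def rayleighSum (η : ℝ) (k : ℕ) (L : ℝ) : ℂ :=
  ∑' ρ : coulombZeros L η, 1 / (ρ : ℂ) ^ k

/-- `p_n^{(α)} = ((-1)^n / 2) ((α+1)/2)^n`. -/
def coulombP (α n : ℕ) : ℝ :=
  (-1) ^ n / 2 * (((α : ℝ) + 1) / 2) ^ n

/-- The recurrence relations for the coefficients; `ζ j n` stands for `ζ_{n,η}^{(j)}`.
They determine `ζ j n` for all `j ≥ 2` and all `n`. -/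
structure IsRayleighCoeff (η : ℝ) (ζ : ℕ → ℕ → ℝ) : Prop where
  two_zero : ζ 2 0 = coulombP 2 0
  two_one : ζ 2 1 = coulombP 2 1
  two_add_two : ∀ n : ℕ, ζ 2 (n + 2) = coulombP 2 (n + 2)
    + ∑ m ∈ Finset.Icc 0 n, (-1) ^ m * η ^ 2 * ((m : ℝ) + 1) * coulombP 2 (n - m)
  even_zero : ∀ k : ℕ, 2 ≤ k → ζ (2 * k) 0 =
    ∑ l ∈ Finset.Icc 0 (k - 2), ζ (2 * l + 2) 0 * ζ (2 * k - 2 * l - 2) 0 * coulombP (2 * k) 0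
  even_one : ∀ k : ℕ, 2 ≤ k → ζ (2 * k) 1 =
    ∑ l ∈ Finset.Icc 0 (k - 2), ∑ q ∈ Finset.Icc 0 1, ∑ m ∈ Finset.Icc 0 q,
      ζ (2 * l + 2) m * ζ (2 * k - 2 * l - 2) (q - m) * coulombP (2 * k) (1 - q)
  even_add_two : ∀ k : ℕ, 2 ≤ k → ∀ n : ℕ, ζ (2 * k) (n + 2) =
    (∑ l ∈ Finset.Icc 1 (k - 2), ∑ q ∈ Finset.Icc 0 n, ∑ m ∈ Finset.Icc 0 q,
      ζ (2 * l + 1) m * ζ (2 * k - 2 * l - 1) (q - m) * coulombP (2 * k) (n - q))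
    + (∑ l ∈ Finset.Icc 0 (k - 2), ∑ q ∈ Finset.Icc 0 (n + 2), ∑ m ∈ Finset.Icc 0 q,
      ζ (2 * l + 2) m * ζ (2 * k - 2 * l - 2) (q - m) * coulombP (2 * k) (n + 2 - q))
    - 2 * η * ∑ l ∈ Finset.Icc 0 n, ∑ m ∈ Finset.Icc 0 l,
      (-1) ^ m * coulombP (2 * k) (l - m) * ζ (2 * k - 1) (n - l)
  three : ∀ n : ℕ, ζ 3 n =
    -2 * η * ∑ l ∈ Finset.Icc 0 n, ∑ m ∈ Finset.Icc 0 l,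
      (-1) ^ m * coulombP 3 (l - m) * ζ 2 (n - l)
  odd : ∀ k : ℕ, 2 ≤ k → ∀ n : ℕ, ζ (2 * k + 1) n =
    -2 * η * (∑ l ∈ Finset.Icc 0 n, ∑ m ∈ Finset.Icc 0 l,
      (-1) ^ m * coulombP (2 * k + 1) (l - m) * ζ (2 * k) (n - l))
    + (∑ l ∈ Finset.Icc 1 (k - 1), ∑ q ∈ Finset.Icc 0 n, ∑ m ∈ Finset.Icc 0 q,
      ζ (2 * l + 1) m * ζ (2 * k - 2 * l) (q - m) * coulombP (2 * k + 1) (n - q))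
    + ∑ l ∈ Finset.Icc 0 (k - 2), ∑ q ∈ Finset.Icc 0 n, ∑ m ∈ Finset.Icc 0 q,
      ζ (2 * l + 2) m * ζ (2 * k - 2 * l - 1) (q - m) * coulombP (2 * k + 1) (n - q)

end

/-! Off the origin, `F_{L,η}` has the zeros of its entire factor φ = `coulombPhi`. For L ≥ 0, φ(0) =
1 and |φ(z)| ≤ exp((2|η|+1)|z|). Since z(φ'' + φ) + 2(L+1)φ' - 2ηφ = 0, a multiple zero of φ would
force φ = 0 (`deriv_coulombPhi_ne_zero`), so summing over distinct zeros loses nothing.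

For a function of exponential type with simple zeros and value 1 at 0, the sum of ρ^{-j} over the
zeros converges absolutely for j ≥ 2 and equals minus the Taylor coefficient of index j-1 of the
logarithmic derivative (`hasSum_zeros_inv_pow`). Zeros in a disc are divided out; Borel–Carathéodory
and Cauchy estimates bound the remaining zero-free factor.

The function Y = φ'/φ solves the Riccati equation z(Y' + Y² + 1) + 2(L+1)Y = 2η. Its coefficients
give (2L+3)Z^{(2)} = 1 + (η/(L+1))² and, for j ≥ 3, (2L+j+1)Z^{(j)} = -2η/(L+1) Z^{(j-1)} +
∑_{p=2}^{j-2} Z^{(p)}Z^{(j-p)} (`rayleighSum_recurrence`).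

The recurrences for ζ are these identities expanded in powers of 1/L: L/(2L+j+1) is the geometric
series with coefficients p_n^{(j)}, valid for L > (j+1)/2, and L/(L+1) has coefficients (-1)^n. For
j = 2k+1 the condition reads L > k+1. Induction on k with absolutely convergent Cauchy products
finishes the proof. -/

/-! ### Zeros of entire functions of exponential type -/

open Complex Metric in
/-- The zeros in a finite set `S` of simple zeros of an entire function can be divided out. -/
theorem exists_eq_mul_prod_one_sub_div {f : ℂ → ℂ} (hf : Differentiable ℂ f)
    (hs : ∀ ρ, f ρ = 0 → deriv f ρ ≠ 0) (S : Finset ℂ) (hS : ∀ ρ ∈ S, f ρ = 0 ∧ ρ ≠ 0) :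
    ∃ g : ℂ → ℂ, Differentiable ℂ g ∧ (∀ z, f z = g z * ∏ ρ ∈ S, (1 - z / ρ)) ∧
      ∀ z, g z = 0 → f z = 0 ∧ z ∉ S := by
  classical
  induction S using Finset.induction_on with
  | empty => exact ⟨f, hf, by simp, by simp⟩
  | insert a S ha ih =>
    obtain ⟨g, hg, hfg, hg0⟩ := ih fun ρ hρ => hS ρ (Finset.mem_insert_of_mem hρ)
    obtain ⟨hfa, ha0⟩ := hS a (Finset.mem_insert_self _ _)
    have hprod : ∏ ρ ∈ S, (1 - a / ρ) ≠ 0 := by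
      refine Finset.prod_ne_zero_iff.2 fun ρ hρ h => ha ?_
      have hρ0 : ρ ≠ 0 := (hS ρ (Finset.mem_insert_of_mem hρ)).2
      rw [sub_eq_zero, eq_div_iff hρ0, one_mul] at h
      exact h ▸ hρ
    have hga : g a = 0 := by
      have := hfg a
      rw [hfa] at this
      exact (mul_eq_zero.1 this.symm).resolve_right hprod
    have hfac : ∀ z, g z = (z - a) * dslope g a z := fun z => by
      have := sub_smul_dslope g a z
      rw [hga, sub_zero, smul_eq_mul] at this
      exact this.symm
    have hd : Differentiable ℂ (dslope g a) := by
      rw [← differentiableOn_univ]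
      exact (differentiableOn_dslope Filter.univ_mem).2 hg.differentiableOn
    -- From g(z) = (z - a) · dslope = (-a · dslope)(1 - z/a).
    refine ⟨fun z => -a * dslope g a z, hd.const_mul _, fun z => ?_, fun z hz => ?_⟩
    · rw [hfg z, hfac z, Finset.prod_insert ha]
      field_simp
      ring
    · have hz : dslope g a z = 0 := by simpa [ha0] using hz
      by_cases hza : z = a
      -- If the new quotient vanished at a, then g(a) = g'(a) = 0, hence f'(a) = 0, against
      -- simplicity.
      · subst hza
        rw [dslope_same] at hz
        refine absurd ?_ (hs z hfa)
        have h1 : HasDerivAt f (deriv g z * (∏ ρ ∈ S, (1 - z / ρ))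
            + g z * deriv (fun w => ∏ ρ ∈ S, (1 - w / ρ)) z) z := by
          rw [funext hfg]
          refine (hg z).hasDerivAt.mul (DifferentiableAt.hasDerivAt ?_)
          fun_prop
        rw [h1.deriv, hz, hga]
        simp
      · have := hg0 z (by rw [hfac z, hz, mul_zero])
        exact ⟨this.1, by simp [hza, this.2]⟩

open Complex Metric in
/-- Bound for the quotient of a function of exponential type by its zeros in a disc. -/
theorem two_pow_card_mul_norm_le {f g : ℂ → ℂ} {A R : ℝ} (hfA : ∀ z, ‖f z‖ ≤ Real.exp (A * ‖z‖))
    (hR : 0 < R) (S : Finset ℂ) (hS : ∀ ρ ∈ S, ρ ≠ 0 ∧ ‖ρ‖ ≤ R) (hg : Differentiable ℂ g)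
    (hfg : ∀ z, f z = g z * ∏ ρ ∈ S, (1 - z / ρ)) {z : ℂ} (hz : ‖z‖ ≤ 3 * R) :
    (2 : ℝ) ^ S.card * ‖g z‖ ≤ Real.exp (3 * A * R) := by
  have hpos : (0 : ℝ) < 2 ^ S.card := by positivity
  rw [mul_comm, ← le_div_iff₀ hpos]
  have h3R : 3 * R ≠ 0 := by positivity
  -- Maximum principle on the disc of radius 3R: on its boundary |w/ρ| ≥ 3, so every divided factor
  -- has norm at least 2.
  refine norm_le_of_forall_mem_frontier_norm_le (U := ball (0 : ℂ) (3 * R)) isBounded_ball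
    hg.diffContOnCl (fun w hw => ?_) (by rw [closure_ball _ h3R]; simpa using hz)
  rw [frontier_ball _ h3R, mem_sphere_zero_iff_norm] at hw
  rw [le_div_iff₀ hpos]
  have h1 : (2 : ℝ) ^ S.card ≤ ‖∏ ρ ∈ S, (1 - w / ρ)‖ := by
    rw [norm_prod, ← Finset.prod_const]
    refine Finset.prod_le_prod (fun _ _ => by norm_num) fun ρ hρ => ?_
    obtain ⟨h0, hle⟩ := hS ρ hρ
    have h0' : 0 < ‖ρ‖ := norm_pos_iff.2 h0
    have : 3 ≤ ‖w / ρ‖ := by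
      rw [norm_div, hw, le_div_iff₀ h0']
      linarith
    have h2 := norm_sub_norm_le (w / ρ) 1
    rw [norm_one, norm_sub_rev] at h2
    linarith
  calc ‖g w‖ * 2 ^ S.card ≤ ‖g w‖ * ‖∏ ρ ∈ S, (1 - w / ρ)‖ := by gcongr
    _ = ‖f w‖ := by rw [hfg w, norm_mul]
    _ ≤ Real.exp (A * ‖w‖) := hfA w
    _ = Real.exp (3 * A * R) := by rw [hw]; ring_nf

/-- An entire function of exponential type with `f 0 = 1` has few zeros in discs about `0`. -/
theorem two_pow_card_le_exp {f : ℂ → ℂ} {A R : ℝ} (hf : Differentiable ℂ f) (hf0 : f 0 = 1)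
    (hfA : ∀ z, ‖f z‖ ≤ Real.exp (A * ‖z‖)) (hs : ∀ ρ, f ρ = 0 → deriv f ρ ≠ 0)
    (hR : 0 < R) (S : Finset ℂ) (hS : ∀ ρ ∈ S, f ρ = 0 ∧ ‖ρ‖ ≤ R) :
    (2 : ℝ) ^ S.card ≤ Real.exp (3 * A * R) := by
  have hne : ∀ ρ ∈ S, ρ ≠ 0 := fun ρ hρ h => by
    have := (hS ρ hρ).1
    simp [h, hf0] at this
  obtain ⟨g, hg, hfg, -⟩ := exists_eq_mul_prod_one_sub_div hf hs S
    fun ρ hρ => ⟨(hS ρ hρ).1, hne ρ hρ⟩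
  have := two_pow_card_mul_norm_le hfA hR S (fun ρ hρ => ⟨hne ρ hρ, (hS ρ hρ).2⟩) hg hfg
    (z := 0) (by simp [hR.le])
  have h0 := hfg 0
  simp only [hf0, zero_div, sub_zero, Finset.prod_const_one, mul_one] at h0
  simpa [← h0] using this

/-- By the zero count, the disc of radius δ·2^k holds at most 2^k zeros. A dyadic decomposition then
dominates the sum by a multiple of ∑ 2^k · 4^{-k}. -/
theorem summable_inv_sq_norm_zeros {f : ℂ → ℂ} {A : ℝ} (hA : 0 < A) (hf : Differentiable ℂ f)
    (hf0 : f 0 = 1) (hfA : ∀ z, ‖f z‖ ≤ Real.exp (A * ‖z‖))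
    (hs : ∀ ρ, f ρ = 0 → deriv f ρ ≠ 0) :
    Summable fun ρ : {ρ : ℂ | f ρ = 0} => 1 / ‖(ρ : ℂ)‖ ^ 2 := by
  classical
  -- Chosen so that exp(3A · δ2^k) = 2^(2^k).
  set δ := Real.log 2 / (3 * A) with hδ
  have hlog : 0 < Real.log 2 := Real.log_pos (by norm_num)
  have hδ0 : 0 < δ := by positivity
  have hcard : ∀ (k : ℕ) (S : Finset ℂ), (∀ ρ ∈ S, f ρ = 0 ∧ ‖ρ‖ ≤ δ * 2 ^ k) →
      S.card ≤ 2 ^ k := fun k S hS => by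
    have h := two_pow_card_le_exp hf hf0 hfA hs (by positivity) S hS
    have h2 : Real.exp (3 * A * (δ * 2 ^ k)) = (2 : ℝ) ^ (2 ^ k) := by
      have : 3 * A * (δ * 2 ^ k) = ((2 ^ k : ℕ) : ℝ) * Real.log 2 := by
        rw [hδ]; push_cast; field_simp
      rw [this, Real.exp_nat_mul, Real.exp_log (by norm_num)]
    rw [h2] at h
    exact (pow_le_pow_iff_right₀ (by norm_num : (1 : ℝ) < 2)).1 h
  have hmin : ∀ ρ, f ρ = 0 → δ ≤ ‖ρ‖ := fun ρ hρ => by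
    have hρ0 : 0 < ‖ρ‖ := norm_pos_iff.2 fun h => by simp [h, hf0] at hρ
    have h := two_pow_card_le_exp hf hf0 hfA hs hρ0 {ρ} (by simp [hρ])
    rw [Finset.card_singleton, pow_one, ← Real.log_le_iff_le_exp (by norm_num)] at h
    rw [hδ, div_le_iff₀ (by positivity)]
    linarith
  clear_value δ
  -- Weights 4^{-k} on whole discs instead of annuli: the first disc containing ρ already accounts
  -- for 1/|ρ|², up to the factor 4/δ².
  let F : ℕ → ℂ → ℝ := fun k ρ => if ‖ρ‖ ≤ δ * 2 ^ k then (1 / 4 : ℝ) ^ k else 0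
  have hF0 : ∀ k ρ, 0 ≤ F k ρ := fun k ρ => by
    simp only [F]; split_ifs <;> positivity
  have hFle : ∀ k ρ, F k ρ ≤ (1 / 4 : ℝ) ^ k := fun k ρ => by
    simp only [F]; split_ifs
    · exact le_rfl
    · positivity
  have hFs : ∀ ρ, Summable fun k => F k ρ := fun ρ =>
    Summable.of_nonneg_of_le (fun k => hF0 k ρ) (fun k => hFle k ρ)
      (summable_geometric_of_lt_one (by norm_num) (by norm_num))
  have hle : ∀ ρ, f ρ = 0 → 1 / ‖ρ‖ ^ 2 ≤ 4 / δ ^ 2 * ∑' k, F k ρ := fun ρ hρ => by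
    obtain ⟨n, hn1, hn2⟩ := exists_nat_pow_near (x := ‖ρ‖ / δ) (y := (2 : ℝ))
      ((one_le_div hδ0).2 (hmin ρ hρ)) (by norm_num)
    rw [le_div_iff₀ hδ0] at hn1
    rw [div_lt_iff₀ hδ0] at hn2
    have h1 : F (n + 1) ρ ≤ ∑' k, F k ρ := (hFs ρ).le_tsum _ fun k _ => hF0 k ρ
    have h2 : F (n + 1) ρ = (1 / 4 : ℝ) ^ (n + 1) := if_pos (by linarith)
    calc 1 / ‖ρ‖ ^ 2 ≤ 1 / (2 ^ n * δ) ^ 2 := by gcongr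
      _ = 4 / δ ^ 2 * (1 / 4 : ℝ) ^ (n + 1) := by
        have : (4 : ℝ) ^ n = (2 ^ n) ^ 2 := by rw [← pow_mul, mul_comm, pow_mul]; norm_num
        rw [pow_succ (1 / 4 : ℝ), div_pow (1 : ℝ) 4 n, one_pow, this]
        field_simp
      _ ≤ _ := by rw [← h2]; gcongr
  have hgeo : Summable fun k : ℕ => (1 / 2 : ℝ) ^ k :=
    summable_geometric_of_lt_one (by norm_num) (by norm_num)
  refine summable_of_sum_le (c := 4 / δ ^ 2 * ∑' k : ℕ, (1 / 2 : ℝ) ^ k)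
    (fun ρ => by positivity) fun u => ?_
  calc ∑ ρ ∈ u, 1 / ‖(ρ : ℂ)‖ ^ 2 ≤ ∑ ρ ∈ u, 4 / δ ^ 2 * ∑' k, F k ρ :=
        Finset.sum_le_sum fun ρ _ => hle ρ ρ.2
    _ = 4 / δ ^ 2 * ∑' k, ∑ ρ ∈ u, F k ρ := by
        rw [← Finset.mul_sum, Summable.tsum_finsetSum (f := fun (ρ : {ρ : ℂ | f ρ = 0}) k => F k ρ)
          fun ρ _ => hFs ρ]
    _ ≤ _ := by
        gcongr with k
        · exact summable_sum fun (ρ : {ρ : ℂ | f ρ = 0}) _ => hFs ρ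
        simp only [F]
        rw [← Finset.sum_filter, Finset.sum_const, nsmul_eq_mul]
        have hc := hcard k ((u.filter fun ρ : {ρ : ℂ | f ρ = 0} => ‖(ρ : ℂ)‖ ≤ δ * 2 ^ k).map
          (Function.Embedding.subtype _)) (by
            intro ρ hρ
            obtain ⟨σ, hσ, rfl⟩ := Finset.mem_map.1 hρ
            exact ⟨σ.2, (Finset.mem_filter.1 hσ).2⟩)
        rw [Finset.card_map] at hc
        have hc' : (((u.filter fun ρ : {ρ : ℂ | f ρ = 0} => ‖(ρ : ℂ)‖ ≤ δ * 2 ^ k).card : ℕ) : ℝ) ≤ 2 ^ k := by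
          exact_mod_cast hc
        calc _ ≤ (2 : ℝ) ^ k * (1 / 4) ^ k := by gcongr
          _ = (1 / 2) ^ k := by rw [← mul_pow]; norm_num

open Complex Metric in
/-- A zero-free holomorphic function on a disc has a holomorphic logarithm. -/
theorem exists_eq_exp_on_ball {g : ℂ → ℂ} {R : ℝ} (hR : 0 < R)
    (hg : Differentiable ℂ g) (hg0 : g 0 = 1) (hne : ∀ z ∈ ball (0 : ℂ) R, g z ≠ 0) :
    ∃ h : ℂ → ℂ, h 0 = 0 ∧ (∀ z ∈ ball (0 : ℂ) R, HasDerivAt h (logDeriv g z) z) ∧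
      ∀ z ∈ ball (0 : ℂ) R, g z = exp (h z) := by
  have hd : DifferentiableOn ℂ (logDeriv g) (ball 0 R) :=
    (hg.deriv.differentiableOn).div hg.differentiableOn hne
  obtain ⟨h, hh0, hh⟩ := hd.isExactOn_ball.with_val_at 0 0
  refine ⟨h, hh0, hh, fun z hz => ?_⟩
  have hder : ∀ w ∈ ball (0 : ℂ) R, HasDerivAt (fun w => g w * exp (-h w)) 0 w := fun w hw => by
    refine ((hg w).hasDerivAt.mul ((hh w hw).neg.cexp)).congr_deriv ?_
    rw [logDeriv_apply]
    field_simp [hne w hw]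
    ring
  have h0 : (0 : ℂ) ∈ ball (0 : ℂ) R := by simpa using hR
  have := (convex_ball (0 : ℂ) R).is_const_of_fderivWithin_eq_zero (𝕜 := ℂ)
    (f := fun w => g w * exp (-h w))
    (fun w hw => (hder w hw).differentiableAt.differentiableWithinAt)
    (fun w hw => by
      rw [fderivWithin_of_isOpen isOpen_ball hw]
      ext
      simpa using (hder w hw).deriv) hz h0
  simp only [hg0, hh0, neg_zero, exp_zero, mul_one] at this
  rw [exp_neg] at this
  field_simp at this
  exact this

theorem iteratedDeriv_inv_sub_zero (n : ℕ) {ρ : ℂ} :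
    iteratedDeriv n (fun z : ℂ => (z - ρ)⁻¹) 0 = -(n.factorial * (1 / ρ ^ (n + 1))) := by
  have h := congrFun (iter_deriv_inv_linear_sub n (1 : ℂ) ρ) 0
  simp only [one_mul, one_pow, mul_one, zero_sub] at h
  rw [iteratedDeriv_eq_iterate, h]
  have : (-1 - (n : ℤ)) = -((n + 1 : ℕ) : ℤ) := by push_cast; ring
  rw [this, zpow_neg, zpow_natCast, neg_pow ρ, mul_inv, pow_succ (-1 : ℂ)]
  have h1 : ((-1 : ℂ) ^ n) * ((-1 : ℂ) ^ n * -1)⁻¹ = -1 := by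
    rcases neg_one_pow_eq_or ℂ n with h | h <;> simp [h]
  linear_combination (n.factorial * (ρ ^ (n + 1))⁻¹ : ℂ) * h1

-- Write f = g ∏(1 - z/ρ) with g = e^h on the disc of radius R, so that f'/f = h' + ∑ 1/(z - ρ).
-- There Re h ≤ 3AR; Borel–Carathéodory gives |h| ≤ 6AR on the circle of radius R/2, and Cauchy's
-- estimate bounds the derivative of order n+1 of h at 0. The result is O(R^{-n}), which tends to 0
-- for n ≥ 1.
open Complex Metric Filter Topology in
theorem norm_sum_zeros_add_iteratedDeriv_logDeriv_le {f : ℂ → ℂ} {A R : ℝ} (hA : 0 < A)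
    (hf : Differentiable ℂ f) (hf0 : f 0 = 1) (hfA : ∀ z, ‖f z‖ ≤ Real.exp (A * ‖z‖))
    (hs : ∀ ρ, f ρ = 0 → deriv f ρ ≠ 0) (hR : 0 < R) (S : Finset ℂ)
    (hS : ∀ ρ, ρ ∈ S ↔ f ρ = 0 ∧ ‖ρ‖ ≤ R) (n : ℕ) :
    ‖∑ ρ ∈ S, (n.factorial * (1 / ρ ^ (n + 1)) : ℂ) + iteratedDeriv n (logDeriv f) 0‖
      ≤ (n + 1).factorial * (6 * A * R) / (R / 2) ^ (n + 1) := by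
  have hne : ∀ ρ ∈ S, ρ ≠ 0 := fun ρ hρ h => by
    have := ((hS ρ).1 hρ).1
    simp [h, hf0] at this
  obtain ⟨g, hg, hfg, hgne⟩ := exists_eq_mul_prod_one_sub_div hf hs S
    fun ρ hρ => ⟨((hS ρ).1 hρ).1, hne ρ hρ⟩
  have hg0 : g 0 = 1 := by
    have h0 := hfg 0
    simpa [hf0] using h0.symm
  have hgball : ∀ z ∈ ball (0 : ℂ) R, g z ≠ 0 := fun z hz h => by
    obtain ⟨h1, h2⟩ := hgne z h
    exact h2 ((hS z).2 ⟨h1, (mem_ball_zero_iff.1 hz).le⟩)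
  obtain ⟨h, hh0, hh, hexp⟩ := exists_eq_exp_on_ball hR hg hg0 hgball
  have hhd : DifferentiableOn ℂ h (ball 0 R) := fun z hz =>
    (hh z hz).differentiableAt.differentiableWithinAt
  have hre : Set.MapsTo h (ball 0 R) {z | z.re ≤ 3 * A * R} := fun z hz => by
    have hzR := (mem_ball_zero_iff.1 hz).le
    have h1 := two_pow_card_mul_norm_le hfA hR S
      (fun ρ hρ => ⟨hne ρ hρ, ((hS ρ).1 hρ).2⟩) hg hfg (z := z) (by linarith)
    have h2 : ‖g z‖ ≤ Real.exp (3 * A * R) := by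
      refine le_trans ?_ h1
      exact le_mul_of_one_le_left (norm_nonneg _) (one_le_pow₀ (by norm_num))
    rw [hexp z hz, norm_exp, Real.exp_le_exp] at h2
    exact h2
  have hbound : ∀ z ∈ sphere (0 : ℂ) (R / 2), ‖h z‖ ≤ 6 * A * R := fun z hz => by
    rw [mem_sphere_zero_iff_norm] at hz
    have := borelCaratheodory_zero (z := z) (by positivity) hhd hre hR
      (by rw [mem_ball_zero_iff, hz]; linarith) hh0
    refine this.trans (le_of_eq ?_)
    rw [hz]
    field_simp
    ring
  have hsub : closedBall (0 : ℂ) (R / 2) ⊆ ball 0 R := closedBall_subset_ball (by linarith)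
  have hcauchy := norm_iteratedDeriv_le_of_forall_mem_sphere_norm_le (n + 1) (half_pos hR)
    (hhd.diffContOnCl_ball hsub) hbound
  have h0mem : ball (0 : ℂ) R ∈ 𝓝 (0 : ℂ) := ball_mem_nhds _ hR
  have hne0 : ∀ᶠ z in 𝓝 (0 : ℂ), ∀ ρ ∈ S, z ≠ ρ := by
    rw [Filter.eventually_all_finset]
    exact fun ρ hρ => (continuous_id.continuousAt).eventually_ne (hne ρ hρ).symm
  have hlog : logDeriv f =ᶠ[𝓝 0] fun z => deriv h z + ∑ ρ ∈ S, (z - ρ)⁻¹ := by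
    filter_upwards [h0mem, hne0] with z hz hzS
    have hfac : ∀ ρ ∈ S, (1 - z / ρ) ≠ 0 := fun ρ hρ h => by
      rw [sub_eq_zero, eq_div_iff (hne ρ hρ), one_mul] at h
      exact hzS ρ hρ h.symm
    rw [(hh z hz).deriv, funext hfg, logDeriv_mul z (hgball z hz)
      (Finset.prod_ne_zero_iff.2 hfac) (hg z) (by fun_prop),
      logDeriv_prod hfac (fun ρ _ => by fun_prop)]
    congr 1
    refine Finset.sum_congr rfl fun ρ hρ => ?_
    have hd : HasDerivAt (fun z : ℂ => 1 - z / ρ) (-(1 / ρ)) z :=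
      ((hasDerivAt_id z).div_const ρ).const_sub 1
    have h1 := hne ρ hρ
    have h2 := hfac ρ hρ
    have h3 := sub_ne_zero.2 (hzS ρ hρ)
    rw [logDeriv_apply, hd.deriv, div_eq_iff h2]
    field_simp
    ring
  have hhan : ContDiffAt ℂ n (deriv h) 0 :=
    ((hhd.analyticAt h0mem).deriv).contDiffAt
  have hinv : ∀ ρ ∈ S, ContDiffAt ℂ n (fun z : ℂ => (z - ρ)⁻¹) 0 := fun ρ hρ =>
    ContDiffAt.inv (by fun_prop) (by simpa using hne ρ hρ)
  rw [hlog.iteratedDeriv_eq n, iteratedDeriv_fun_add hhan (ContDiffAt.sum hinv),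
    iteratedDeriv_fun_sum hinv, ← iteratedDeriv_succ']
  simp only [iteratedDeriv_inv_sub_zero, Finset.sum_neg_distrib]
  rw [add_comm, add_assoc, neg_add_cancel, add_zero]
  exact hcauchy

open Complex Metric Filter Topology in
/-- Power sums of the reciprocals of the zeros of a function of exponential type with
simple zeros. -/
theorem hasSum_zeros_inv_pow {f : ℂ → ℂ} {A : ℝ} (hA : 0 < A) (hf : Differentiable ℂ f)
    (hf0 : f 0 = 1) (hfA : ∀ z, ‖f z‖ ≤ Real.exp (A * ‖z‖))
    (hs : ∀ ρ, f ρ = 0 → deriv f ρ ≠ 0) {n : ℕ} (hn : 1 ≤ n) :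
    HasSum (fun ρ : {ρ : ℂ | f ρ = 0} => 1 / (ρ : ℂ) ^ (n + 1))
      (-(iteratedDeriv n (logDeriv f) 0 / n.factorial)) := by
  classical
  have hsum2 := summable_inv_sq_norm_zeros hA hf hf0 hfA hs
  -- The terms of a summable family tend to 0 along the cofinite filter, so only finitely many zeros
  -- lie in a disc.
  have hfin : ∀ R : ℝ, {ρ : {ρ : ℂ | f ρ = 0} | ‖(ρ : ℂ)‖ ≤ R}.Finite := fun R => by
    have h := hsum2.tendsto_cofinite_zero.eventually
      (gt_mem_nhds (show (0 : ℝ) < 1 / (|R| + 1) ^ 2 by positivity))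
    refine Set.Finite.subset (eventually_cofinite.1 h) fun ρ hρ hlt => ?_
    have hρ0 : 0 < ‖(ρ : ℂ)‖ := norm_pos_iff.2 fun h => by
      have := ρ.2
      simp [h, hf0] at this
    have hρR : ‖(ρ : ℂ)‖ ≤ |R| + 1 := by
      have := le_abs_self R
      have : ‖(ρ : ℂ)‖ ≤ R := hρ
      linarith
    have : 1 / (|R| + 1) ^ 2 ≤ 1 / ‖(ρ : ℂ)‖ ^ 2 := by gcongr
    linarith
  have hbdd : ∀ᶠ ρ : {ρ : ℂ | f ρ = 0} in cofinite, 1 ≤ ‖(ρ : ℂ)‖ := by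
    refine eventually_cofinite.2 ((hfin 1).subset fun ρ hρ => ?_)
    exact (not_le.1 hρ).le
  have hsummable : Summable fun ρ : {ρ : ℂ | f ρ = 0} => 1 / (ρ : ℂ) ^ (n + 1) := by
    refine Summable.of_norm_bounded_eventually hsum2 ?_
    filter_upwards [hbdd] with ρ hρ
    rw [norm_div, norm_one, norm_pow]
    gcongr
    omega
  -- The discs of radius N exhaust the zeros; absolute convergence identifies the limit along them
  -- with the full sum.
  let T : ℕ → Finset {ρ : ℂ | f ρ = 0} := fun N => (hfin N).toFinset
  have hT : Tendsto T atTop atTop := by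
    refine tendsto_atTop_finset_of_monotone (fun M N hMN ρ hρ => ?_) fun ρ => ?_
    · simp only [T, Set.Finite.mem_toFinset, Set.mem_ofPred_eq] at hρ ⊢
      exact hρ.trans (by exact_mod_cast hMN)
    · obtain ⟨N, hN⟩ := exists_nat_ge ‖(ρ : ℂ)‖
      exact ⟨N, by simpa [T] using hN⟩
  have hlim := hsummable.hasSum.comp hT
  have hfact : (n.factorial : ℂ) ≠ 0 := by exact_mod_cast n.factorial_ne_zero
  have hlim2 : Tendsto (fun N => ∑ ρ ∈ T N, 1 / (ρ : ℂ) ^ (n + 1)) atTop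
      (𝓝 (-(iteratedDeriv n (logDeriv f) 0 / n.factorial))) := by
    rw [tendsto_iff_norm_sub_tendsto_zero]
    have hz : Tendsto (fun N : ℕ =>
        ((n + 1).factorial * (6 * A) * 2 ^ (n + 1) : ℝ) * (1 / (N : ℝ))) atTop (𝓝 0) := by
      simpa using (tendsto_one_div_atTop_nhds_zero_nat (𝕜 := ℝ)).const_mul
        ((n + 1).factorial * (6 * A) * 2 ^ (n + 1) : ℝ)
    refine squeeze_zero' (Eventually.of_forall fun _ => norm_nonneg _) ?_ hz
    filter_upwards [eventually_ge_atTop 1] with N hN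
    have hN' : (1 : ℝ) ≤ N := by exact_mod_cast hN
    have key := norm_sum_zeros_add_iteratedDeriv_logDeriv_le hA hf hf0 hfA hs
      (R := N) (by linarith) ((T N).map (Function.Embedding.subtype _)) (fun ρ => by
        simp only [T, Finset.mem_map, Set.Finite.mem_toFinset, Function.Embedding.subtype_apply]
        exact ⟨fun ⟨a, ha, hae⟩ => hae ▸ ⟨a.2, ha⟩, fun h => ⟨⟨ρ, h.1⟩, h.2, rfl⟩⟩) n
    rw [Finset.sum_map, ← Finset.mul_sum] at key
    have heq : (∑ ρ ∈ T N, 1 / (ρ : ℂ) ^ (n + 1)) - -(iteratedDeriv n (logDeriv f) 0 / n.factorial)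
        = (n.factorial : ℂ)⁻¹ * (n.factorial * ∑ ρ ∈ T N, 1 / (ρ : ℂ) ^ (n + 1)
          + iteratedDeriv n (logDeriv f) 0) := by
      field_simp
      ring
    have hinv : ‖(n.factorial : ℂ)⁻¹‖ ≤ 1 := by
      rw [norm_inv, Complex.norm_natCast]
      exact inv_le_one_of_one_le₀ (by exact_mod_cast n.factorial_pos)
    rw [heq, norm_mul]
    refine (mul_le_of_le_one_left (norm_nonneg _) hinv).trans (key.trans ?_)
    -- Here n ≥ 1 is essential: it makes the error O(1/N).
    have hpow : (N : ℝ) ^ 2 ≤ (N : ℝ) ^ (n + 1) := pow_le_pow_right₀ hN' (by omega)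
    rw [div_pow, div_div_eq_mul_div, mul_one_div, div_le_div_iff₀ (by positivity) (by linarith)]
    calc _ = ((n + 1).factorial * (6 * A) * 2 ^ (n + 1)) * (N : ℝ) ^ 2 := by ring
      _ ≤ _ := by gcongr
  have := tendsto_nhds_unique hlim hlim2
  rw [← this]
  exact hsummable.hasSum

/-! ### The entire factor of the Coulomb function and its differential equation -/

theorem iteratedDeriv_succ_id_mul {W : ℂ → ℂ} {c : ℂ} (hW : AnalyticAt ℂ W c) (m : ℕ) :
    iteratedDeriv (m + 1) (fun z => z * W z) c
      = c * iteratedDeriv (m + 1) W c + (m + 1) * iteratedDeriv m W c := by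
  rw [iteratedDeriv_fun_mul contDiffAt_fun_id hW.contDiffAt, Finset.sum_range_succ',
    Finset.sum_range_succ', Finset.sum_eq_zero]
  · simp [iteratedDeriv_fun_id]
    ring
  · intro i _
    simp [iteratedDeriv_fun_id]

/-- The entire part `∑ a_{L,n} z^n` of the regular Coulomb wave function. -/
noncomputable def coulombPhi (L η : ℝ) (z : ℂ) : ℂ := ∑' n : ℕ, (coulombCoeff L η n : ℂ) * z ^ n

/-- Exponential type comes from here. With K = 2|η| + 1 one has 2|η| = K - 1 and K ≥ 1, and the
induction reduces to K(K-1) + n + 1 ≤ K²(n + 3 + 2L). -/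
theorem abs_coulombCoeff_le {L : ℝ} (hL : 0 ≤ L) (η : ℝ) (n : ℕ) :
    |coulombCoeff L η n| ≤ (2 * |η| + 1) ^ n / n.factorial := by
  induction n using Nat.twoStepInduction with
  | zero => simp [coulombCoeff]
  | one =>
    simp only [coulombCoeff, abs_div, pow_one, Nat.factorial_one, Nat.cast_one, div_one]
    rw [abs_of_pos (by linarith : 0 < L + 1), div_le_iff₀ (by linarith)]
    nlinarith [abs_nonneg η]
  | more n ih0 ih1 =>
    set K := 2 * |η| + 1 with hK
    have hK1 : 1 ≤ K := by have := abs_nonneg η; linarith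
    have hn : (0 : ℝ) ≤ n := n.cast_nonneg
    have hden : 0 < ((n : ℝ) + 2) * (((n : ℝ) + 2) + 2 * L + 1) := by positivity
    have hf : (0 : ℝ) < n.factorial := by exact_mod_cast n.factorial_pos
    rw [coulombCoeff, abs_div, abs_of_pos hden, div_le_iff₀ hden]
    have e1 : ((n + 1).factorial : ℝ) = (n + 1) * n.factorial := by
      rw [Nat.factorial_succ]; push_cast; ring
    have e2 : ((n + 2).factorial : ℝ) = (n + 2) * ((n + 1) * n.factorial) := by
      rw [Nat.factorial_succ, Nat.factorial_succ]; push_cast; ring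
    calc |2 * η * coulombCoeff L η (n + 1) - coulombCoeff L η n|
        ≤ |2 * η * coulombCoeff L η (n + 1)| + |coulombCoeff L η n| := abs_sub _ _
      _ ≤ 2 * |η| * (K ^ (n + 1) / (n + 1).factorial) + K ^ n / n.factorial := by
          rw [abs_mul, abs_mul, abs_two]
          gcongr
      _ = K ^ n / n.factorial * ((K - 1) * K / (n + 1) + 1) := by
          rw [e1, hK]; field_simp; ring
      _ ≤ K ^ n / n.factorial * (K ^ 2 * (n + 2 + 2 * L + 1) / (n + 1)) := by
          gcongr
          rw [div_add_one (by positivity)]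
          gcongr
          nlinarith [mul_nonneg hn (by nlinarith : 0 ≤ K ^ 2 - 1), mul_nonneg hL (sq_nonneg K)]
      _ = _ := by rw [e2]; field_simp; ring

theorem norm_coulombCoeff_mul_pow_le {L : ℝ} (hL : 0 ≤ L) (η : ℝ) (z : ℂ) (n : ℕ) :
    ‖(coulombCoeff L η n : ℂ) * z ^ n‖ ≤ ((2 * |η| + 1) * ‖z‖) ^ n / n.factorial := by
  rw [norm_mul, norm_pow, Complex.norm_real, Real.norm_eq_abs, mul_pow, mul_div_right_comm]
  gcongr
  exact abs_coulombCoeff_le hL η n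

theorem norm_coulombPhi_le {L : ℝ} (hL : 0 ≤ L) (η : ℝ) (z : ℂ) :
    ‖coulombPhi L η z‖ ≤ Real.exp ((2 * |η| + 1) * ‖z‖) := by
  refine tsum_of_norm_bounded ?_ (norm_coulombCoeff_mul_pow_le hL η z)
  rw [Real.exp_eq_exp_ℝ]
  exact NormedSpace.expSeries_div_hasSum_exp _

theorem coulombPhi_zero (L η : ℝ) : coulombPhi L η 0 = 1 := by
  rw [coulombPhi, tsum_eq_single 0 fun n hn => by simp [hn]]
  simp [coulombCoeff]

theorem hasFPowerSeriesOnBall_coulombPhi {L : ℝ} (hL : 0 ≤ L) (η : ℝ) :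
    HasFPowerSeriesOnBall (coulombPhi L η)
      (FormalMultilinearSeries.ofScalars ℂ fun n => (coulombCoeff L η n : ℂ)) 0 ⊤ := by
  have hs : ∀ z, Summable fun n => ‖(coulombCoeff L η n : ℂ) * z ^ n‖ := fun z =>
    Summable.of_nonneg_of_le (fun _ => norm_nonneg _) (norm_coulombCoeff_mul_pow_le hL η z)
      (Real.summable_pow_div_factorial _)
  refine ⟨?_, by simp, fun {z} _ => ?_⟩
  · rw [FormalMultilinearSeries.radius_eq_top_of_summable_norm]
    intro r
    convert hs (r : ℝ) using 2 with n
    rw [FormalMultilinearSeries.ofScalars_norm, norm_mul, norm_pow, Complex.norm_real (r : ℝ),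
      NNReal.norm_eq]
  · simp only [FormalMultilinearSeries.ofScalars_apply_eq, smul_eq_mul, zero_add]
    exact (hs z).of_norm.hasSum

theorem differentiable_coulombPhi {L : ℝ} (hL : 0 ≤ L) (η : ℝ) :
    Differentiable ℂ (coulombPhi L η) := by
  rw [← differentiableOn_univ]
  simpa using (hasFPowerSeriesOnBall_coulombPhi hL η).differentiableOn

theorem iteratedDeriv_coulombPhi_zero {L : ℝ} (hL : 0 ≤ L) (η : ℝ) (n : ℕ) :
    iteratedDeriv n (coulombPhi L η) 0 = n.factorial * coulombCoeff L η n := by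
  have := (hasFPowerSeriesOnBall_coulombPhi hL η).factorial_smul (1 : ℂ) n
  rw [iteratedDeriv_eq_iteratedFDeriv, ← this]
  simp

/-- The differential operator of the reduced Coulomb equation. -/
noncomputable def coulombOp (L η : ℝ) (f : ℂ → ℂ) (z : ℂ) : ℂ :=
  z * (deriv (deriv f) z + f z) + (2 * (L + 1) * deriv f z - 2 * η * f z)

/-- A general centre `c` serves two uses: at 0 the leading term drops out and the recurrence for the
coefficients appears; at a zero ρ ≠ 0 the leading term determines the next derivative from lower
ones. -/
theorem iteratedDeriv_succ_coulombOp {f : ℂ → ℂ} (hf : Differentiable ℂ f) (L η : ℝ) (m : ℕ)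
    (c : ℂ) : iteratedDeriv (m + 1) (coulombOp L η f) c
      = c * (iteratedDeriv (m + 3) f c + iteratedDeriv (m + 1) f c)
        + (m + 1) * (iteratedDeriv (m + 2) f c + iteratedDeriv m f c)
        + (2 * (L + 1) * iteratedDeriv (m + 2) f c - 2 * η * iteratedDeriv (m + 1) f c) := by
  have h0 : AnalyticAt ℂ f c := hf.analyticAt c
  have h1 : AnalyticAt ℂ (deriv f) c := hf.deriv.analyticAt c
  have h2 : AnalyticAt ℂ (deriv (deriv f)) c := hf.deriv.deriv.analyticAt c
  have hW : AnalyticAt ℂ (fun z => deriv (deriv f) z + f z) c := h2.add h0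
  have e : coulombOp L η f = fun z => z * (deriv (deriv f) z + f z)
    + (2 * (L + 1) * deriv f z - 2 * η * f z) := rfl
  have hA : ∀ k : ℕ, iteratedDeriv k (fun z => deriv (deriv f) z + f z) c
      = iteratedDeriv (k + 2) f c + iteratedDeriv k f c := fun k => by
    rw [iteratedDeriv_fun_add h2.contDiffAt h0.contDiffAt, iteratedDeriv_succ', iteratedDeriv_succ']
  have hzW : AnalyticAt ℂ (fun z => z * (deriv (deriv f) z + f z)) c := analyticAt_id.mul hW
  have h3 : AnalyticAt ℂ (fun z => 2 * ((L : ℂ) + 1) * deriv f z) c := analyticAt_const.mul h1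
  have h4 : AnalyticAt ℂ (fun z => 2 * (η : ℂ) * f z) c := analyticAt_const.mul h0
  rw [e, iteratedDeriv_fun_add hzW.contDiffAt (h3.fun_sub h4).contDiffAt,
    iteratedDeriv_succ_id_mul hW, hA, hA, iteratedDeriv_fun_sub h3.contDiffAt h4.contDiffAt,
    iteratedDeriv_const_mul_field, iteratedDeriv_const_mul_field, ← iteratedDeriv_succ']

theorem eq_zero_of_iteratedDeriv_eq_zero {f : ℂ → ℂ} (hf : Differentiable ℂ f) (c : ℂ)
    (h : ∀ n, iteratedDeriv n f c = 0) (z : ℂ) : f z = 0 := by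
  rw [← Complex.taylorSeries_eq_of_entire' c z hf]
  simp [h]

theorem coulombOp_coulombPhi {L : ℝ} (hL : 0 ≤ L) (η : ℝ) (z : ℂ) :
    coulombOp L η (coulombPhi L η) z = 0 := by
  have hφ := differentiable_coulombPhi hL η
  refine eq_zero_of_iteratedDeriv_eq_zero ?_ 0 (fun n => ?_) z
  · have h0 := hφ.deriv
    have h1 := hφ.deriv.deriv
    unfold coulombOp
    fun_prop
  · cases n with
    | zero =>
      have h1 := iteratedDeriv_coulombPhi_zero hL η 1
      have hL1 : (L : ℂ) + 1 ≠ 0 := by exact_mod_cast (by linarith : L + 1 ≠ 0)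
      simp only [iteratedDeriv_one] at h1
      simp only [iteratedDeriv_zero, coulombOp, h1, coulombPhi_zero, coulombCoeff]
      push_cast
      field_simp
      simp
    | succ m =>
      have hden : ((m : ℂ) + 2) * (((m : ℂ) + 2) + 2 * L + 1) ≠ 0 := by
        exact_mod_cast (by positivity : ((m : ℝ) + 2) * (((m : ℝ) + 2) + 2 * L + 1) ≠ 0)
      have hrec : (coulombCoeff L η (m + 2) : ℂ) * (((m : ℂ) + 2) * (((m : ℂ) + 2) + 2 * L + 1))
          = 2 * η * coulombCoeff L η (m + 1) - coulombCoeff L η m := by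
        rw [coulombCoeff]
        push_cast
        exact div_mul_cancel₀ _ hden
      rw [iteratedDeriv_succ_coulombOp hφ]
      simp only [iteratedDeriv_coulombPhi_zero hL, Nat.factorial_succ]
      push_cast
      linear_combination ((m + 1) * m.factorial : ℂ) * hrec

/-- Uniqueness for the equation away from its singular point 0: a double zero would annihilate every
derivative at ρ, hence φ itself, although φ(0) = 1. -/
theorem deriv_coulombPhi_ne_zero {L : ℝ} (hL : 0 ≤ L) (η : ℝ) {ρ : ℂ}
    (hρ : coulombPhi L η ρ = 0) : deriv (coulombPhi L η) ρ ≠ 0 := by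
  intro hd
  have hφ := differentiable_coulombPhi hL η
  have hρ0 : ρ ≠ 0 := fun h => by simp [h, coulombPhi_zero] at hρ
  have hop : coulombOp L η (coulombPhi L η) = fun _ => 0 := funext (coulombOp_coulombPhi hL η)
  have hall : ∀ n, iteratedDeriv n (coulombPhi L η) ρ = 0
      ∧ iteratedDeriv (n + 1) (coulombPhi L η) ρ = 0
      ∧ iteratedDeriv (n + 2) (coulombPhi L η) ρ = 0 := fun n => by
    induction n with
    | zero =>
      refine ⟨by simpa using hρ, by simpa [iteratedDeriv_one] using hd, ?_⟩
      have := coulombOp_coulombPhi hL η ρ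
      simpa [coulombOp, hρ, hd, hρ0, iteratedDeriv_succ] using this
    | succ m ih =>
      obtain ⟨h0, h1, h2⟩ := ih
      refine ⟨h1, h2, ?_⟩
      have := iteratedDeriv_succ_coulombOp hφ L η m ρ
      rw [hop, h0, h1, h2] at this
      simpa [hρ0] using this
  have := eq_zero_of_iteratedDeriv_eq_zero hφ ρ (fun n => (hall n).1) 0
  simp [coulombPhi_zero] at this

theorem coulombC_ne_zero {L : ℝ} (hL : 0 ≤ L) (η : ℝ) : coulombC L η ≠ 0 := by
  have h1 : Complex.Gamma ((L : ℂ) + 1 + Complex.I * (η : ℂ)) ≠ 0 :=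
    Complex.Gamma_ne_zero_of_re_pos (by simp; linarith)
  have h2 : 0 < Real.Gamma (2 * L + 2) := Real.Gamma_pos_of_pos (by linarith)
  have h3 : 0 < ‖Complex.Gamma ((L : ℂ) + 1 + Complex.I * (η : ℂ))‖ := norm_pos_iff.2 h1
  unfold coulombC
  positivity

theorem coulombZeros_eq {L : ℝ} (hL : 0 ≤ L) (η : ℝ) :
    coulombZeros L η = {ρ : ℂ | coulombPhi L η ρ = 0} := by
  ext ρ
  have hC : (coulombC L η : ℂ) ≠ 0 := by exact_mod_cast coulombC_ne_zero hL η
  constructor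
  · rintro ⟨h0, h⟩
    change (coulombC L η : ℂ) * ρ ^ ((L : ℂ) + 1) * coulombPhi L η ρ = 0 at h
    have hp : ρ ^ ((L : ℂ) + 1) ≠ 0 := by simp [Complex.cpow_eq_zero_iff, h0]
    exact (mul_eq_zero.1 h).resolve_left (mul_ne_zero hC hp)
  · intro h
    refine ⟨fun h0 => ?_, ?_⟩
    · have h' : coulombPhi L η ρ = 0 := h
      simp [h0, coulombPhi_zero] at h'
    · change (coulombC L η : ℂ) * ρ ^ ((L : ℂ) + 1) * coulombPhi L η ρ = 0
      rw [show coulombPhi L η ρ = 0 from h, mul_zero]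

/-! ### The Riccati equation for the logarithmic derivative -/

/-- Taylor coefficients at `0` of the logarithmic derivative of `coulombPhi`. -/
noncomputable def coulombY (L η : ℝ) (n : ℕ) : ℂ :=
  iteratedDeriv n (logDeriv (coulombPhi L η)) 0 / n.factorial

theorem hasSum_rayleigh {L : ℝ} (hL : 0 ≤ L) (η : ℝ) {n : ℕ} (hn : 1 ≤ n) :
    HasSum (fun ρ : coulombZeros L η => 1 / (ρ : ℂ) ^ (n + 1)) (-coulombY L η n) := by
  have h := hasSum_zeros_inv_pow (f := coulombPhi L η) (A := 2 * |η| + 1) (by positivity)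
    (differentiable_coulombPhi hL η) (coulombPhi_zero L η) (norm_coulombPhi_le hL η)
    (fun ρ => deriv_coulombPhi_ne_zero hL η) hn
  rw [coulombZeros_eq hL]
  exact h

theorem analyticAt_logDeriv_coulombPhi {L : ℝ} (hL : 0 ≤ L) (η : ℝ) :
    AnalyticAt ℂ (logDeriv (coulombPhi L η)) 0 := by
  have hφ := differentiable_coulombPhi hL η
  exact (hφ.deriv.analyticAt 0).div (hφ.analyticAt 0) (by simp [coulombPhi_zero])

-- Divide the linear equation by φ and use φ''/φ = Y' + Y². Validity near 0, where φ ≠ 0, is enough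
-- for Taylor coefficients.
open Filter Topology in
theorem coulomb_riccati {L : ℝ} (hL : 0 ≤ L) (η : ℝ) :
    (fun z => z * (deriv (logDeriv (coulombPhi L η)) z
        + logDeriv (coulombPhi L η) z * logDeriv (coulombPhi L η) z + 1)
      + 2 * (L + 1) * logDeriv (coulombPhi L η) z) =ᶠ[𝓝 0] fun _ => (2 * η : ℂ) := by
  have hφ := differentiable_coulombPhi hL η
  have hne : ∀ᶠ z in 𝓝 (0 : ℂ), coulombPhi L η z ≠ 0 :=
    hφ.continuous.continuousAt.eventually_ne (by simp [coulombPhi_zero])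
  filter_upwards [hne] with z hz
  have hd : deriv (logDeriv (coulombPhi L η)) z = (deriv (deriv (coulombPhi L η)) z
      * coulombPhi L η z - deriv (coulombPhi L η) z * deriv (coulombPhi L η) z)
      / coulombPhi L η z ^ 2 :=
    ((hφ.deriv z).hasDerivAt.div (hφ z).hasDerivAt hz).deriv
  have hode := coulombOp_coulombPhi hL η z
  unfold coulombOp at hode
  rw [hd, logDeriv_apply]
  field_simp
  linear_combination coulombPhi L η z * hode

theorem coulombY_zero {L : ℝ} (hL : 0 ≤ L) (η : ℝ) : coulombY L η 0 = η / (L + 1) := by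
  have hL1 : (L : ℂ) + 1 ≠ 0 := by exact_mod_cast (by linarith : L + 1 ≠ 0)
  have h := (coulomb_riccati hL η).eq_of_nhds
  rw [coulombY, iteratedDeriv_zero, Nat.factorial_zero, Nat.cast_one, div_one, eq_div_iff hL1]
  linear_combination (1 / 2) * h

/-- The coefficient of z^{m+1} in the Riccati equation; the `if` is the contribution of the bare
summand z. -/
theorem coulombY_succ {L : ℝ} (hL : 0 ≤ L) (η : ℝ) (m : ℕ) :
    (m + 1 + 2 * (L + 1)) * coulombY L η (m + 1)
      + ∑ i ∈ Finset.range (m + 1), coulombY L η i * coulombY L η (m - i)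
      + (if m = 0 then 1 else 0) = 0 := by
  have hY := analyticAt_logDeriv_coulombPhi hL η
  have hYY := hY.fun_mul hY
  have hD := hY.deriv.fun_add hYY
  have hW := hD.fun_add (analyticAt_const (v := (1 : ℂ)))
  have hzW := analyticAt_id.fun_mul hW
  have hc := (analyticAt_const (v := 2 * ((L : ℂ) + 1))).fun_mul hY
  have h := (coulomb_riccati hL η).iteratedDeriv_eq (m + 1)
  simp only [id] at hzW
  rw [iteratedDeriv_fun_add hzW.contDiffAt hc.contDiffAt, iteratedDeriv_const_mul_field,
      iteratedDeriv_succ_id_mul hW, zero_mul, zero_add,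
      iteratedDeriv_fun_add hD.contDiffAt contDiffAt_const,
      iteratedDeriv_fun_add hY.deriv.contDiffAt hYY.contDiffAt,
      iteratedDeriv_fun_mul hY.contDiffAt hY.contDiffAt, ← iteratedDeriv_succ',
      iteratedDeriv_const, iteratedDeriv_const, if_neg (Nat.succ_ne_zero m)] at h
  have hf : ∀ k : ℕ, (k.factorial : ℂ) ≠ 0 := fun k => by exact_mod_cast k.factorial_ne_zero
  have hy : ∀ k, iteratedDeriv k (logDeriv (coulombPhi L η)) 0
      = k.factorial * coulombY L η k := fun k => by
    rw [coulombY, mul_div_cancel₀ _ (hf k)]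
  have hsum : ∑ i ∈ Finset.range (m + 1), (m.choose i : ℂ)
      * iteratedDeriv i (logDeriv (coulombPhi L η)) 0
      * iteratedDeriv (m - i) (logDeriv (coulombPhi L η)) 0
      = m.factorial * ∑ i ∈ Finset.range (m + 1), coulombY L η i * coulombY L η (m - i) := by
    rw [Finset.mul_sum]
    refine Finset.sum_congr rfl fun i hi => ?_
    have hc := Nat.choose_mul_factorial_mul_factorial
      (Nat.lt_succ_iff.1 (Finset.mem_range.1 hi))
    have hc' : (m.choose i : ℂ) * i.factorial * (m - i).factorial = m.factorial := by
      exact_mod_cast hc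
    rw [hy, hy, ← hc']
    ring
  rw [hsum, hy, Nat.factorial_succ] at h
  have hm := hf m
  have hm1 : (m : ℂ) + 1 ≠ 0 := by exact_mod_cast m.succ_ne_zero
  have hone : (if m = 0 then (1 : ℂ) else 0) = m.factorial * (if m = 0 then 1 else 0) := by
    split_ifs with h0
    · simp [h0]
    · simp
  rw [hone] at h
  push_cast at h
  have h2 : ((m : ℂ) + 1) * m.factorial * ((m + 1 + 2 * (L + 1)) * coulombY L η (m + 1)
      + ∑ i ∈ Finset.range (m + 1), coulombY L η i * coulombY L η (m - i)
      + (if m = 0 then 1 else 0)) = 0 := by linear_combination h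
  exact (mul_eq_zero.1 h2).resolve_left (mul_ne_zero hm1 hm)

/-! ### Existence of the coefficient sequences -/

/-- One step of the recurrences for the coefficients, in terms of the earlier sequences `z`. -/
noncomputable def rayleighStep (η : ℝ) (j : ℕ) (z : ℕ → ℕ → ℝ) (n : ℕ) : ℝ :=
  if j = 2 then
    match n with
    | 0 => coulombP 2 0
    | 1 => coulombP 2 1
    | n + 2 => coulombP 2 (n + 2)
      + ∑ m ∈ Finset.Icc 0 n, (-1) ^ m * η ^ 2 * ((m : ℝ) + 1) * coulombP 2 (n - m)
  else if j % 2 = 0 then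
    match n with
    | 0 => ∑ l ∈ Finset.Icc 0 (j / 2 - 2),
        z (2 * l + 2) 0 * z (2 * (j / 2) - 2 * l - 2) 0 * coulombP (2 * (j / 2)) 0
    | 1 => ∑ l ∈ Finset.Icc 0 (j / 2 - 2), ∑ q ∈ Finset.Icc 0 1, ∑ m ∈ Finset.Icc 0 q,
        z (2 * l + 2) m * z (2 * (j / 2) - 2 * l - 2) (q - m) * coulombP (2 * (j / 2)) (1 - q)
    | n + 2 =>
      (∑ l ∈ Finset.Icc 1 (j / 2 - 2), ∑ q ∈ Finset.Icc 0 n, ∑ m ∈ Finset.Icc 0 q,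
        z (2 * l + 1) m * z (2 * (j / 2) - 2 * l - 1) (q - m) * coulombP (2 * (j / 2)) (n - q))
      + (∑ l ∈ Finset.Icc 0 (j / 2 - 2), ∑ q ∈ Finset.Icc 0 (n + 2), ∑ m ∈ Finset.Icc 0 q,
        z (2 * l + 2) m * z (2 * (j / 2) - 2 * l - 2) (q - m)
          * coulombP (2 * (j / 2)) (n + 2 - q))
      - 2 * η * ∑ l ∈ Finset.Icc 0 n, ∑ m ∈ Finset.Icc 0 l,
        (-1) ^ m * coulombP (2 * (j / 2)) (l - m) * z (2 * (j / 2) - 1) (n - l)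
  else if j = 3 then
    -2 * η * ∑ l ∈ Finset.Icc 0 n, ∑ m ∈ Finset.Icc 0 l,
      (-1) ^ m * coulombP 3 (l - m) * z 2 (n - l)
  else
    -2 * η * (∑ l ∈ Finset.Icc 0 n, ∑ m ∈ Finset.Icc 0 l,
      (-1) ^ m * coulombP (2 * (j / 2) + 1) (l - m) * z (2 * (j / 2)) (n - l))
    + (∑ l ∈ Finset.Icc 1 (j / 2 - 1), ∑ q ∈ Finset.Icc 0 n, ∑ m ∈ Finset.Icc 0 q,
      z (2 * l + 1) m * z (2 * (j / 2) - 2 * l) (q - m) * coulombP (2 * (j / 2) + 1) (n - q))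
    + ∑ l ∈ Finset.Icc 0 (j / 2 - 2), ∑ q ∈ Finset.Icc 0 n, ∑ m ∈ Finset.Icc 0 q,
      z (2 * l + 2) m * z (2 * (j / 2) - 2 * l - 1) (q - m) * coulombP (2 * (j / 2) + 1) (n - q)

/-- The coefficients of the Laurent expansions of the Rayleigh sums. -/
noncomputable def rayleighCoeff (η : ℝ) (j : ℕ) : ℕ → ℝ :=
  -- Cutting off at indices i ≥ j makes the recursion well-founded; no relation in `IsRayleighCoeff`
  -- reads the default value 0.
  rayleighStep η j fun i => if _ : i < j then rayleighCoeff η i else 0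
termination_by j

theorem isRayleighCoeff_rayleighCoeff (η : ℝ) : IsRayleighCoeff η (rayleighCoeff η) := by
  have hk2 : ∀ k : ℕ, 2 * k / 2 = k := fun k => by omega
  have hk3 : ∀ k : ℕ, (2 * k + 1) / 2 = k := fun k => by omega
  have hk4 : ∀ k : ℕ, 2 * k % 2 = 0 := fun k => by omega
  have hk5 : ∀ k : ℕ, ¬ (2 * k + 1) % 2 = 0 := fun k => by omega
  constructor
  · rw [rayleighCoeff, rayleighStep.eq_def, if_pos rfl]
  · rw [rayleighCoeff, rayleighStep.eq_def, if_pos rfl]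
  · intro n; rw [rayleighCoeff, rayleighStep.eq_def, if_pos rfl]
  · intro k hk
    rw [rayleighCoeff, rayleighStep.eq_def, if_neg (by omega), if_pos (hk4 k)]
    simp only [hk2]
    refine Finset.sum_congr rfl fun l hl => ?_
    rw [Finset.mem_Icc] at hl
    rw [dif_pos (by omega), dif_pos (by omega)]
  · intro k hk
    rw [rayleighCoeff, rayleighStep.eq_def, if_neg (by omega), if_pos (hk4 k)]
    simp only [hk2]
    refine Finset.sum_congr rfl fun l hl => ?_
    rw [Finset.mem_Icc] at hl
    rw [dif_pos (by omega), dif_pos (by omega)]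
  · intro k hk n
    rw [rayleighCoeff, rayleighStep.eq_def, if_neg (by omega), if_pos (hk4 k)]
    simp only [hk2]
    refine congrArg₂ _ (congrArg₂ _ (Finset.sum_congr rfl fun l hl => ?_)
      (Finset.sum_congr rfl fun l hl => ?_)) ?_
    · rw [Finset.mem_Icc] at hl
      rw [dif_pos (by omega), dif_pos (by omega)]
    · rw [Finset.mem_Icc] at hl
      rw [dif_pos (by omega), dif_pos (by omega)]
    · rw [dif_pos (by omega)]
  · intro n
    rw [rayleighCoeff, rayleighStep.eq_def, if_neg (by omega), if_neg (by omega), if_pos rfl,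
      dif_pos (by omega)]
  · intro k hk n
    rw [rayleighCoeff, rayleighStep.eq_def, if_neg (by omega), if_neg (hk5 k), if_neg (by omega)]
    simp only [hk3]
    refine congrArg₂ _ (congrArg₂ _ ?_ (Finset.sum_congr rfl fun l hl => ?_))
      (Finset.sum_congr rfl fun l hl => ?_)
    · rw [dif_pos (by omega)]
    · rw [Finset.mem_Icc] at hl
      rw [dif_pos (by omega), dif_pos (by omega)]
    · rw [Finset.mem_Icc] at hl
      rw [dif_pos (by omega), dif_pos (by omega)]

/-! ### Calculus of convergent series in 1/L -/

/-- `HasLaurentSum L f s` says that `∑ f n / L ^ n` converges to `s`. -/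
def HasLaurentSum (L : ℝ) (f : ℕ → ℝ) (s : ℂ) : Prop :=
  HasSum (fun n => ((f n / L ^ n : ℝ) : ℂ)) s

namespace HasLaurentSum

variable {L : ℝ} {f g : ℕ → ℝ} {s t : ℂ}

theorem congr (hf : HasLaurentSum L f s) (h : ∀ n, g n = f n) (hst : t = s) :
    HasLaurentSum L g t := by
  rw [funext h, hst]; exact hf

theorem add (hf : HasLaurentSum L f s) (hg : HasLaurentSum L g t) :
    HasLaurentSum L (fun n => f n + g n) (s + t) := by
  unfold HasLaurentSum at *
  simpa [add_div] using HasSum.add hf hg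

theorem const_mul (c : ℝ) (hf : HasLaurentSum L f s) :
    HasLaurentSum L (fun n => c * f n) (c * s) := by
  unfold HasLaurentSum at *
  simpa [mul_div_assoc] using HasSum.mul_left (c : ℂ) hf

theorem sum {ι : Type*} {I : Finset ι} {f : ι → ℕ → ℝ} {s : ι → ℂ}
    (h : ∀ i ∈ I, HasLaurentSum L (f i) (s i)) :
    HasLaurentSum L (fun n => ∑ i ∈ I, f i n) (∑ i ∈ I, s i) := by
  unfold HasLaurentSum at *
  simpa [Finset.sum_div] using hasSum_sum h

/-- A sum in ℂ in the sense of `HasSum` converges absolutely, so the Cauchy product applies. -/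
theorem mul (hf : HasLaurentSum L f s) (hg : HasLaurentSum L g t) :
    HasLaurentSum L (fun n => ∑ m ∈ Finset.Icc 0 n, f m * g (n - m)) (s * t) := by
  have h := (summable_norm_sum_mul_range_of_summable_norm hf.summable.norm
    hg.summable.norm).of_norm.hasSum
  rw [← tsum_mul_tsum_eq_tsum_sum_range_of_summable_norm hf.summable.norm hg.summable.norm,
    hf.tsum_eq, hg.tsum_eq] at h
  unfold HasLaurentSum
  convert! h using 2 with n
  rw [Nat.range_succ_eq_Icc_zero]
  push_cast
  rw [Finset.sum_div]
  refine Finset.sum_congr rfl fun m hm => ?_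
  have e : (L : ℂ) ^ n = L ^ m * L ^ (n - m) := by
    rw [← pow_add, Nat.add_sub_cancel' (Finset.mem_Icc.1 hm).2]
  rw [e, mul_div_mul_comm]

theorem mul_mul {p : ℕ → ℝ} {r : ℂ} (hf : HasLaurentSum L f s)
    (hg : HasLaurentSum L g t) (hp : HasLaurentSum L p r) :
    HasLaurentSum L (fun n => ∑ q ∈ Finset.Icc 0 n, ∑ m ∈ Finset.Icc 0 q,
      f m * g (q - m) * p (n - q)) (s * t * r) :=
  ((hf.mul hg).mul hp).congr (fun n => by simp only [Finset.sum_mul]) rfl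

/-- A Laurent series shifted by two places. -/
theorem shift_two (hf : HasLaurentSum L (fun n => f (n + 2)) s) (h0 : f 0 = 0)
    (h1 : f 1 = 0) : HasLaurentSum L f (s / L ^ 2) := by
  unfold HasLaurentSum at *
  rw [← hasSum_nat_add_iff' 2]
  have := HasSum.mul_right ((L : ℂ) ^ 2)⁻¹ hf
  simp only [Finset.sum_range_succ, Finset.sum_range_zero, h0, h1, zero_div, Complex.ofReal_zero,
    add_zero, sub_zero, div_eq_mul_inv s]
  convert! this using 2 with n
  push_cast
  rw [pow_add, div_eq_mul_inv, div_eq_mul_inv, mul_inv, mul_assoc]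

end HasLaurentSum

/-- Geometric series for (1/2)/(1 + (α+1)/(2L)). With α = 2k+1 its condition is L > k+1, the range
in the theorem. -/
theorem hasLaurentSum_coulombP {L : ℝ} {α : ℕ} (hL : (α + 1 : ℝ) / 2 < L) :
    HasLaurentSum L (coulombP α) (L / (2 * L + α + 1)) := by
  have hα : (0 : ℝ) ≤ α := α.cast_nonneg
  have hL0 : 0 < L := by linarith
  have h := hasSum_geometric_of_abs_lt_one (r := -((α + 1 : ℝ) / 2 / L)) (by
    rw [abs_neg, abs_of_nonneg (by positivity), div_lt_one hL0]; exact hL)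
  have h2 := (h.mul_left (1 / 2)).mapL (Complex.ofRealCLM)
  unfold HasLaurentSum
  convert h2 using 2 with n
  · simp only [coulombP, Complex.ofRealCLM_apply, Complex.ofReal_inj]
    rw [← neg_div, ← neg_one_mul ((α + 1 : ℝ) / 2), div_pow _ L n, mul_pow]
    ring
  · simp only [Complex.ofRealCLM_apply]
    norm_cast
    push_cast
    have h3 : 2 * L + α + 1 ≠ 0 := by positivity
    have h2 : 1 - -((α + 1 : ℝ) / 2 / L) = (2 * L + α + 1) / (2 * L) := by field_simp; ring
    rw [h2, inv_div]
    field_simp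

theorem hasLaurentSum_neg_one_pow {L : ℝ} (hL : 1 < L) :
    HasLaurentSum L (fun n => (-1) ^ n) (L / (L + 1)) := by
  have h : HasLaurentSum L (coulombP 1) _ := hasLaurentSum_coulombP (by norm_num; exact hL)
  refine (h.const_mul 2).congr (fun n => ?_) ?_
  · norm_num [coulombP]; ring
  · have : (L : ℂ) + 1 ≠ 0 := by exact_mod_cast (by linarith : L + 1 ≠ 0)
    have h3 : 2 * (L : ℂ) + (1 : ℕ) + 1 = 2 * (L + 1) := by push_cast; ring
    rw [h3]
    push_cast
    field_simp

theorem hasLaurentSum_neg_one_pow_mul_succ {L : ℝ} (hL : 1 < L) :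
    HasLaurentSum L (fun n => (-1) ^ n * ((n : ℝ) + 1)) ((L / (L + 1)) ^ 2) := by
  have h := hasLaurentSum_neg_one_pow hL
  refine (h.mul h).congr (fun n => ?_) (sq _)
  rw [Finset.sum_congr rfl fun m hm => by
    rw [← pow_add, Nat.add_sub_cancel' (Finset.mem_Icc.1 hm).2]]
  simp [mul_comm]

/-- The convolution is split by parity because odd and even Rayleigh sums are normalised by
different powers of L. -/
theorem sum_range_odd_eq_add (g : ℕ → ℂ) (n : ℕ) :
    ∑ i ∈ Finset.range (2 * n + 1), g (i + 2)
      = ∑ l ∈ Finset.Icc 1 n, g (2 * l + 1) + ∑ l ∈ Finset.Icc 0 n, g (2 * l + 2) := by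
  induction n with
  | zero => simp
  | succ n ih =>
    rw [show 2 * (n + 1) + 1 = 2 * n + 1 + 1 + 1 by ring, Finset.sum_range_succ,
      Finset.sum_range_succ, ih, Finset.sum_Icc_succ_top (by omega),
      Finset.sum_Icc_succ_top (by omega)]
    ring_nf

theorem sum_range_even_eq_add (g : ℕ → ℂ) (n : ℕ) :
    ∑ i ∈ Finset.range (2 * n + 2), g (i + 2)
      = ∑ l ∈ Finset.Icc 1 (n + 1), g (2 * l + 1) + ∑ l ∈ Finset.Icc 0 n, g (2 * l + 2) := by
  rw [Finset.sum_range_succ, sum_range_odd_eq_add, Finset.sum_Icc_succ_top (by omega)]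
  ring_nf

/-! ### Recurrences for the Rayleigh sums and their expansions -/

theorem two_mul_add_three_mul_rayleighSum_two {L : ℝ} (hL : 0 ≤ L) (η : ℝ) :
    (2 * L + 3) * rayleighSum η 2 L = 1 + (η / (L + 1)) ^ 2 := by
  have h1 : rayleighSum η 2 L = -coulombY L η 1 := (hasSum_rayleigh hL η le_rfl).tsum_eq
  have h := coulombY_succ hL η 0
  simp only [zero_add, Finset.sum_range_one, Nat.sub_zero, if_true, coulombY_zero hL,
    Nat.cast_zero] at h
  rw [h1]
  linear_combination -h

/-- In the convolution of `coulombY_succ` the two end terms contain Y_0 = η/(L+1) and give the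
linear term; in the others the two minus signs cancel. -/
theorem rayleighSum_recurrence {L : ℝ} (hL : 0 ≤ L) (η : ℝ) (m : ℕ) :
    (2 * L + m + 4) * rayleighSum η (m + 3) L
      = -2 * η / (L + 1) * rayleighSum η (m + 2) L
        + ∑ i ∈ Finset.range m, rayleighSum η (i + 2) L * rayleighSum η (m + 3 - (i + 2)) L := by
  have hZ : ∀ n, rayleighSum η (n + 2) L = -coulombY L η (n + 1) := fun n =>
    (hasSum_rayleigh hL η (by omega)).tsum_eq
  have h := coulombY_succ hL η (m + 1)
  rw [Finset.sum_range_succ, Finset.sum_range_succ', coulombY_zero hL, Nat.sub_self,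
    coulombY_zero hL, if_neg (Nat.succ_ne_zero m), Nat.sub_zero] at h
  have hs : ∑ i ∈ Finset.range m, rayleighSum η (i + 2) L * rayleighSum η (m + 3 - (i + 2)) L
      = ∑ i ∈ Finset.range m, coulombY L η (i + 1) * coulombY L η (m - i) := by
    refine Finset.sum_congr rfl fun i hi => ?_
    have hi' := Finset.mem_range.1 hi
    rw [show m + 3 - (i + 2) = (m - i - 1) + 2 by omega, hZ, hZ,
      show m - i - 1 + 1 = m - i by omega, neg_mul_neg]
  rw [hs, hZ m, hZ (m + 1)]
  push_cast at h
  linear_combination -h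

section Laurent

variable {η L : ℝ} {ζ : ℕ → ℕ → ℝ}

theorem hasLaurentSum_two (hζ : IsRayleighCoeff η ζ) (hL : 2 < L) :
    HasLaurentSum L (ζ 2) (L * rayleighSum η 2 L) := by
  have hL0 : L ≠ 0 := by linarith
  have hP : HasLaurentSum L (coulombP 2) (L / (2 * L + (2 : ℕ) + 1)) :=
    hasLaurentSum_coulombP (by norm_num; linarith)
  have hG := ((hasLaurentSum_neg_one_pow_mul_succ (L := L) (by linarith)).const_mul (η ^ 2)).mul hP
  -- (η/(L+1))² = L^{-2} · η²(L/(L+1))², whence the shift by two places.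
  have hS : HasLaurentSum L (fun n => ζ 2 n - coulombP 2 n) _ :=
    HasLaurentSum.shift_two (hG.congr (fun n => by
      rw [hζ.two_add_two, add_sub_cancel_left]
      exact Finset.sum_congr rfl fun m _ => by ring) rfl)
      (by rw [hζ.two_zero, sub_self]) (by rw [hζ.two_one, sub_self])
  refine (hS.add hP).congr (fun n => by ring) ?_
  have h := two_mul_add_three_mul_rayleighSum_two (L := L) (by linarith) η
  have h1 : (L : ℂ) ≠ 0 := by exact_mod_cast hL0
  have h2 : (L : ℂ) + 1 ≠ 0 := by exact_mod_cast (by linarith : L + 1 ≠ 0)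
  have h3 : 2 * (L : ℂ) + 3 ≠ 0 := by exact_mod_cast (by linarith : 2 * L + 3 ≠ 0)
  have h4 : 2 * (L : ℂ) + (2 : ℕ) + 1 = 2 * L + 3 := by push_cast; ring
  rw [h4, eq_div_of_mul_eq h3 ((mul_comm _ _).trans h)]
  push_cast
  field_simp
  ring

theorem hasLaurentSum_three (hζ : IsRayleighCoeff η ζ) (hL : 2 < L) :
    HasLaurentSum L (ζ 3) (L ^ 3 * rayleighSum η 3 L) := by
  have hL0 : L ≠ 0 := by linarith
  have hP : HasLaurentSum L (coulombP 3) (L / (2 * L + (3 : ℕ) + 1)) :=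
    hasLaurentSum_coulombP (by norm_num; linarith)
  have hG := ((hasLaurentSum_neg_one_pow (L := L) (by linarith)).mul_mul hP
    (hasLaurentSum_two hζ hL)).const_mul (-2 * η)
  refine hG.congr hζ.three ?_
  have h := rayleighSum_recurrence (L := L) (by linarith) η 0
  simp only [zero_add, Finset.range_zero, Finset.sum_empty, add_zero, Nat.cast_zero] at h
  have h2 : (L : ℂ) + 1 ≠ 0 := by exact_mod_cast (by linarith : L + 1 ≠ 0)
  have h3 : 2 * (L : ℂ) + 4 ≠ 0 := by exact_mod_cast (by linarith : 2 * L + 4 ≠ 0)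
  have h4 : 2 * (L : ℂ) + (3 : ℕ) + 1 = 2 * L + 4 := by push_cast; ring
  rw [h4, eq_div_of_mul_eq h3 ((mul_comm _ _).trans h)]
  push_cast
  field_simp

/-- Order count for weight 2k, k = n+2: even-even products, divided by 2L+2k+1, carry the prefactor
L^{-(2k-1)}, while odd-odd products and the linear term carry L^{-(2k+1)}. The latter therefore
enter two places later. -/
theorem hasLaurentSum_even_step (hζ : IsRayleighCoeff η ζ) (n : ℕ) (hL : (n : ℝ) + 3 < L)
    (hE : ∀ i, 1 ≤ i → i < n + 2 →
      HasLaurentSum L (ζ (2 * i)) (L ^ (2 * i - 1) * rayleighSum η (2 * i) L))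
    (hO : ∀ i, 1 ≤ i → i < n + 2 →
      HasLaurentSum L (ζ (2 * i + 1)) (L ^ (2 * i + 1) * rayleighSum η (2 * i + 1) L)) :
    HasLaurentSum L (ζ (2 * (n + 2)))
      (L ^ (2 * (n + 2) - 1) * rayleighSum η (2 * (n + 2)) L) := by
  have hn : (0 : ℝ) ≤ n := n.cast_nonneg
  have hL0 : L ≠ 0 := by linarith
  have hP : HasLaurentSum L (coulombP (2 * (n + 2))) (L / (2 * L + (2 * (n + 2) : ℕ) + 1)) :=
    hasLaurentSum_coulombP (by push_cast; linarith)
  set P : ℂ := L / (2 * L + (2 * (n + 2) : ℕ) + 1) with hPdef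
  have hodd := HasLaurentSum.sum (L := L) (I := Finset.Icc 1 (n + 2 - 2))
    (f := fun l N => ∑ q ∈ Finset.Icc 0 N, ∑ m ∈ Finset.Icc 0 q, ζ (2 * l + 1) m
      * ζ (2 * (n + 2) - 2 * l - 1) (q - m) * coulombP (2 * (n + 2)) (N - q))
    (s := fun l => L ^ (2 * n + 4) * P
      * (rayleighSum η (2 * l + 1) L * rayleighSum η (2 * n + 4 - (2 * l + 1)) L)) (by
      intro l hl
      rw [Finset.mem_Icc] at hl
      have h2 := hO (n + 1 - l) (by omega) (by omega)
      rw [show 2 * (n + 1 - l) + 1 = 2 * (n + 2) - 2 * l - 1 by omega] at h2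
      refine ((hO l (by omega) (by omega)).mul_mul h2 hP).congr (fun _ => rfl) ?_
      have e : (L : ℂ) ^ (2 * n + 4) = L ^ (2 * l + 1) * L ^ (2 * (n + 2) - 2 * l - 1) := by
        rw [← pow_add]; congr 1; omega
      rw [e, show 2 * n + 4 - (2 * l + 1) = 2 * (n + 2) - 2 * l - 1 by omega]
      ring)
  have heven := HasLaurentSum.sum (L := L) (I := Finset.Icc 0 (n + 2 - 2))
    (f := fun l N => ∑ q ∈ Finset.Icc 0 N, ∑ m ∈ Finset.Icc 0 q, ζ (2 * l + 2) m
      * ζ (2 * (n + 2) - 2 * l - 2) (q - m) * coulombP (2 * (n + 2)) (N - q))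
    (s := fun l => L ^ (2 * n + 2) * P
      * (rayleighSum η (2 * l + 2) L * rayleighSum η (2 * n + 4 - (2 * l + 2)) L)) (by
      intro l hl
      rw [Finset.mem_Icc] at hl
      have h2 := hE (n + 1 - l) (by omega) (by omega)
      rw [show 2 * (n + 1 - l) = 2 * (n + 2) - 2 * l - 2 by omega] at h2
      refine ((hE (l + 1) (by omega) (by omega)).mul_mul h2 hP).congr (fun _ => rfl) ?_
      have e : (L : ℂ) ^ (2 * n + 2)
          = L ^ (2 * (l + 1) - 1) * L ^ (2 * (n + 2) - 2 * l - 2 - 1) := by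
        rw [← pow_add]; congr 1; omega
      rw [e, show 2 * n + 4 - (2 * l + 2) = 2 * (n + 2) - 2 * l - 2 by omega,
        show 2 * (l + 1) = 2 * l + 2 by ring]
      ring)
  have hgeo := ((hasLaurentSum_neg_one_pow (L := L) (by linarith)).mul_mul hP
    (hO (n + 1) (by omega) (by omega))).const_mul (-2 * η)
  rw [← Finset.mul_sum] at hodd heven
  -- After subtracting the even-even part, `even_zero` and `even_one` say exactly that the first two
  -- coefficients vanish.
  have hS := HasLaurentSum.shift_two (f := fun N => ζ (2 * (n + 2)) N
      - ∑ l ∈ Finset.Icc 0 (n + 2 - 2), ∑ q ∈ Finset.Icc 0 N, ∑ m ∈ Finset.Icc 0 q,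
        ζ (2 * l + 2) m * ζ (2 * (n + 2) - 2 * l - 2) (q - m) * coulombP (2 * (n + 2)) (N - q))
    ((hodd.add hgeo).congr (fun N => by
      rw [hζ.even_add_two (n + 2) (by omega), show 2 * (n + 2) - 1 = 2 * (n + 1) + 1 by omega]
      ring) rfl)
    (by rw [hζ.even_zero (n + 2) (by omega)]; simp)
    (by rw [hζ.even_one (n + 2) (by omega), sub_self])
  refine (hS.add heven).congr (fun N => by ring) ?_
  have h := rayleighSum_recurrence (L := L) (by linarith) η (2 * n + 1)
  rw [sum_range_odd_eq_add (fun p => rayleighSum η p L * rayleighSum η (2 * n + 1 + 3 - p) L)] at h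
  simp only [show 2 * n + 1 + 3 = 2 * n + 4 by ring, show 2 * n + 1 + 2 = 2 * n + 3 by ring] at h
  simp only [show n + 2 - 2 = n by omega, show 2 * (n + 2) = 2 * n + 4 by ring,
    show 2 * n + 4 - 1 = 2 * n + 3 by omega, show 2 * (n + 1) + 1 = 2 * n + 3 by ring] at hPdef ⊢
  have h1 : (L : ℂ) ≠ 0 := by exact_mod_cast hL0
  have h2 : (L : ℂ) + 1 ≠ 0 := by exact_mod_cast (by linarith : L + 1 ≠ 0)
  have h3 : 2 * (L : ℂ) + (2 * n + 4 : ℕ) + 1 ≠ 0 := by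
    exact_mod_cast (by push_cast; linarith : 2 * L + (2 * n + 4 : ℕ) + 1 ≠ 0)
  have h4 : P * (2 * (L : ℂ) + (2 * n + 4 : ℕ) + 1) = L := by
    rw [hPdef]; exact div_mul_cancel₀ _ h3
  have h5 : (L : ℂ) * rayleighSum η (2 * n + 4) L = P * (-2 * η / (L + 1)
      * rayleighSum η (2 * n + 3) L
      + (∑ l ∈ Finset.Icc 1 n, rayleighSum η (2 * l + 1) L
          * rayleighSum η (2 * n + 4 - (2 * l + 1)) L
        + ∑ l ∈ Finset.Icc 0 n, rayleighSum η (2 * l + 2) L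
          * rayleighSum η (2 * n + 4 - (2 * l + 2)) L)) := by
    rw [← h]
    push_cast at h4 ⊢
    linear_combination (-rayleighSum η (2 * n + 4) L) * h4
  have h6 : (L : ℂ) ^ (2 * n + 3) * rayleighSum η (2 * n + 4) L
      = L ^ (2 * n + 2) * (L * rayleighSum η (2 * n + 4) L) := by ring
  clear_value P
  rw [h6, h5]
  push_cast
  field_simp
  ring

/-- Here all contributions carry the same prefactor L^{-(2k+1)}, so no shift occurs. The linear term
involves weight 2k itself, hence `hE` includes i = n+2. -/
theorem hasLaurentSum_odd_step (hζ : IsRayleighCoeff η ζ) (n : ℕ) (hL : (n : ℝ) + 3 < L)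
    (hE : ∀ i, 1 ≤ i → i ≤ n + 2 →
      HasLaurentSum L (ζ (2 * i)) (L ^ (2 * i - 1) * rayleighSum η (2 * i) L))
    (hO : ∀ i, 1 ≤ i → i < n + 2 →
      HasLaurentSum L (ζ (2 * i + 1)) (L ^ (2 * i + 1) * rayleighSum η (2 * i + 1) L)) :
    HasLaurentSum L (ζ (2 * (n + 2) + 1))
      (L ^ (2 * (n + 2) + 1) * rayleighSum η (2 * (n + 2) + 1) L) := by
  have hn : (0 : ℝ) ≤ n := n.cast_nonneg
  have hL0 : L ≠ 0 := by linarith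
  have hP : HasLaurentSum L (coulombP (2 * (n + 2) + 1))
      (L / (2 * L + (2 * (n + 2) + 1 : ℕ) + 1)) :=
    hasLaurentSum_coulombP (by push_cast; linarith)
  set P : ℂ := L / (2 * L + (2 * (n + 2) + 1 : ℕ) + 1) with hPdef
  have hodd := HasLaurentSum.sum (L := L) (I := Finset.Icc 1 (n + 2 - 1))
    (f := fun l N => ∑ q ∈ Finset.Icc 0 N, ∑ m ∈ Finset.Icc 0 q, ζ (2 * l + 1) m
      * ζ (2 * (n + 2) - 2 * l) (q - m) * coulombP (2 * (n + 2) + 1) (N - q))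
    (s := fun l => L ^ (2 * n + 4) * P
      * (rayleighSum η (2 * l + 1) L * rayleighSum η (2 * n + 5 - (2 * l + 1)) L)) (by
      intro l hl
      rw [Finset.mem_Icc] at hl
      have h2 := hE (n + 2 - l) (by omega) (by omega)
      rw [show 2 * (n + 2 - l) = 2 * (n + 2) - 2 * l by omega] at h2
      refine ((hO l (by omega) (by omega)).mul_mul h2 hP).congr (fun _ => rfl) ?_
      have e : (L : ℂ) ^ (2 * n + 4) = L ^ (2 * l + 1) * L ^ (2 * (n + 2) - 2 * l - 1) := by
        rw [← pow_add]; congr 1; omega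
      rw [e, show 2 * n + 5 - (2 * l + 1) = 2 * (n + 2) - 2 * l by omega]
      ring)
  have heven := HasLaurentSum.sum (L := L) (I := Finset.Icc 0 (n + 2 - 2))
    (f := fun l N => ∑ q ∈ Finset.Icc 0 N, ∑ m ∈ Finset.Icc 0 q, ζ (2 * l + 2) m
      * ζ (2 * (n + 2) - 2 * l - 1) (q - m) * coulombP (2 * (n + 2) + 1) (N - q))
    (s := fun l => L ^ (2 * n + 4) * P
      * (rayleighSum η (2 * l + 2) L * rayleighSum η (2 * n + 5 - (2 * l + 2)) L)) (by
      intro l hl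
      rw [Finset.mem_Icc] at hl
      have h2 := hO (n + 1 - l) (by omega) (by omega)
      rw [show 2 * (n + 1 - l) + 1 = 2 * (n + 2) - 2 * l - 1 by omega] at h2
      refine ((hE (l + 1) (by omega) (by omega)).mul_mul h2 hP).congr (fun _ => rfl) ?_
      have e : (L : ℂ) ^ (2 * n + 4)
          = L ^ (2 * (l + 1) - 1) * L ^ (2 * (n + 2) - 2 * l - 1) := by
        rw [← pow_add]; congr 1; omega
      rw [e, show 2 * n + 5 - (2 * l + 2) = 2 * (n + 2) - 2 * l - 1 by omega,
        show 2 * (l + 1) = 2 * l + 2 by ring]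
      ring)
  have hgeo := ((hasLaurentSum_neg_one_pow (L := L) (by linarith)).mul_mul hP
    (hE (n + 2) (by omega) le_rfl)).const_mul (-2 * η)
  rw [← Finset.mul_sum] at hodd heven
  refine ((hgeo.add hodd).add heven).congr (hζ.odd (n + 2) (by omega)) ?_
  have h := rayleighSum_recurrence (L := L) (by linarith) η (2 * n + 2)
  rw [sum_range_even_eq_add (fun p => rayleighSum η p L * rayleighSum η (2 * n + 2 + 3 - p) L)] at h
  simp only [show 2 * n + 2 + 3 = 2 * n + 5 by ring, show 2 * n + 2 + 2 = 2 * n + 4 by ring] at h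
  simp only [show n + 2 - 2 = n by omega, show n + 2 - 1 = n + 1 by omega,
    show 2 * (n + 2) = 2 * n + 4 by ring, show 2 * n + 4 + 1 = 2 * n + 5 by ring,
    show 2 * n + 4 - 1 = 2 * n + 3 by omega] at hPdef ⊢
  have h1 : (L : ℂ) ≠ 0 := by exact_mod_cast hL0
  have h2 : (L : ℂ) + 1 ≠ 0 := by exact_mod_cast (by linarith : L + 1 ≠ 0)
  have h3 : 2 * (L : ℂ) + (2 * n + 5 : ℕ) + 1 ≠ 0 := by
    exact_mod_cast (by push_cast; linarith : 2 * L + (2 * n + 5 : ℕ) + 1 ≠ 0)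
  have h4 : P * (2 * (L : ℂ) + (2 * n + 5 : ℕ) + 1) = L := by
    rw [hPdef]; exact div_mul_cancel₀ _ h3
  have h5 : (L : ℂ) * rayleighSum η (2 * n + 5) L = P * (-2 * η / (L + 1)
      * rayleighSum η (2 * n + 4) L
      + (∑ l ∈ Finset.Icc 1 (n + 1), rayleighSum η (2 * l + 1) L
          * rayleighSum η (2 * n + 5 - (2 * l + 1)) L
        + ∑ l ∈ Finset.Icc 0 n, rayleighSum η (2 * l + 2) L
          * rayleighSum η (2 * n + 5 - (2 * l + 2)) L)) := by
    rw [← h]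
    push_cast at h4 ⊢
    linear_combination (-rayleighSum η (2 * n + 5) L) * h4
  have h6 : (L : ℂ) ^ (2 * n + 5) * rayleighSum η (2 * n + 5) L
      = L ^ (2 * n + 4) * (L * rayleighSum η (2 * n + 5) L) := by ring
  clear_value P
  rw [h6, h5]
  push_cast
  field_simp
  ring

theorem hasLaurentSum_rayleighSum (hζ : IsRayleighCoeff η ζ) (k : ℕ) (hk : 1 ≤ k)
    (hL : (k : ℝ) + 1 < L) :
    HasLaurentSum L (ζ (2 * k)) (L ^ (2 * k - 1) * rayleighSum η (2 * k) L) ∧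
      HasLaurentSum L (ζ (2 * k + 1)) (L ^ (2 * k + 1) * rayleighSum η (2 * k + 1) L) := by
  induction k using Nat.strong_induction_on with
  | _ k ih =>
    obtain _ | _ | n := k
    · omega
    · have hL2 : 2 < L := by push_cast at hL; linarith
      exact ⟨by simpa using hasLaurentSum_two hζ hL2, by simpa using hasLaurentSum_three hζ hL2⟩
    · have hL3 : (n : ℝ) + 3 < L := by push_cast at hL; linarith
      have hlt : ∀ i, i < n + 2 → (i : ℝ) + 1 < L := fun i hi => by
        have : (i : ℝ) + 1 ≤ n + 2 := by exact_mod_cast hi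
        linarith
      have hE := fun i (h1 : 1 ≤ i) (h2 : i < n + 2) => (ih i h2 h1 (hlt i h2)).1
      have hO := fun i (h1 : 1 ≤ i) (h2 : i < n + 2) => (ih i h2 h1 (hlt i h2)).2
      have he := hasLaurentSum_even_step hζ n hL3 hE hO
      -- The even expansion at the current k is fed into the odd step.
      refine ⟨he, hasLaurentSum_odd_step hζ n hL3 (fun i h1 h2 => ?_) hO⟩
      obtain h | rfl := Nat.lt_or_eq_of_le h2
      · exact hE i h1 h
      · exact he

end Laurent

theorem HasLaurentSum.summable_and_eq {L : ℝ} {f : ℕ → ℝ} {s : ℂ} {e : ℕ} (hL : L ≠ 0)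
    (h : HasLaurentSum L f (L ^ e * s)) : Summable (fun n => f n / L ^ n) ∧
      s = ((1 / L ^ e * ∑' n, f n / L ^ n : ℝ) : ℂ) := by
  have hs : Summable fun n => f n / L ^ n := Complex.summable_ofReal.1 h.summable
  refine ⟨hs, ?_⟩
  have h1 : (L : ℂ) ≠ 0 := by exact_mod_cast hL
  have h2 := h.unique (Complex.hasSum_ofReal.2 hs.hasSum)
  push_cast at h2 ⊢
  rw [← h2]
  field_simp

theorem mainTheorem5 (η : ℝ) :
    ∃ ζ : ℕ → ℕ → ℝ, IsRayleighCoeff η ζ ∧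
      ∀ k : ℕ, 1 ≤ k → ∀ L : ℝ, (k : ℝ) + 1 < L →
        (Summable (fun ρ : coulombZeros L η => 1 / (ρ : ℂ) ^ (2 * k)) ∧
          Summable (fun n : ℕ => ζ (2 * k) n / L ^ n) ∧
          rayleighSum η (2 * k) L =
            ((1 / L ^ (2 * k - 1) * ∑' n : ℕ, ζ (2 * k) n / L ^ n : ℝ) : ℂ)) ∧
        (Summable (fun ρ : coulombZeros L η => 1 / (ρ : ℂ) ^ (2 * k + 1)) ∧
          Summable (fun n : ℕ => ζ (2 * k + 1) n / L ^ n) ∧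
          rayleighSum η (2 * k + 1) L =
            ((1 / L ^ (2 * k + 1) * ∑' n : ℕ, ζ (2 * k + 1) n / L ^ n : ℝ) : ℂ)) := by
  have hζ := isRayleighCoeff_rayleighCoeff η
  refine ⟨rayleighCoeff η, hζ, fun k hk L hL => ?_⟩
  have hk0 : (0 : ℝ) ≤ k := k.cast_nonneg
  obtain ⟨h1, h2⟩ := hasLaurentSum_rayleighSum hζ k hk hL
  have hsum := fun n (hn : 1 ≤ n) =>
    (hasSum_rayleigh (L := L) (by linarith) η hn).summable
  have he := hsum (2 * k - 1) (by omega)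
  rw [Nat.sub_add_cancel (by omega)] at he
  have hL0 : L ≠ 0 := by linarith
  exact ⟨⟨he, h1.summable_and_eq hL0⟩, hsum (2 * k) (by omega), h2.summable_and_eq hL0⟩
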